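/- **Setting.** Let $k$ be a commutative ring and $\mathcal A=k[\hbar]/\hbar^2$. Let $D$ be a flat affine group scheme over $k$ whose cotangent space at the identity is a finitely generated free $k$-module (for example any affine algebraic group over a field), let $G\subset D$ be a closed subgroup with restriction map $f\colon\mathcal O(D)\to\mathcal O(G)$, and let $c\in\mathrm{Sym}^2(\mathfrak d)^D$ be nondegenerate with $\mathfrak g\subset\mathfrak d$ Lagrangian, so that $(D,G)$ is a group pair. $\mathcal O(D/G)$ is regarded as the right $\mathcal O(D)$-comodule algebra $\{d\in\mathcal O(D): f(d_{(1)})\otimes d_{(2)}=1\otimes d\}$ (this is the algebra of functions on $D/G$ through inversion on $D$), with infinitesimal action $\tilde a(x).d=d_{(0)}x(d_{(1)})$ of $x\in\mathfrak d$. For a Lagrangian complement $\mathfrak h\subset\mathfrak d$ to $\mathfrak g$ let $p_{\mathfrak h}\colon\mathfrak d^*\cong\mathfrak d\to\mathfrak g$ be the projection along $\mathfrak h$, $r_{\mathfrak h}=\sum_i e_i\otimes p_{\mathfrak h}(e^i)\in\mathfrak d\otimes\mathfrak g$ for a basis $e_i$ of $\mathfrak d$ with dual basis $e^i$, let $\pi_G^{\mathfrak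 h}$ be the bracket $\{f(d),b\}=r_{\mathfrak h}(d_{(2)},b_{(2)})\,b_{(1)}f(d_{(1)})-r_{\mathfrak h}(d_{(1)},b_{(1)})\,f(d_{(2)})b_{(2)}$ on $\mathcal O(G)$, and let $\varphi^{\mathfrak h}\in\wedge^3\mathfrak g$ be $(\xi,\eta,\zeta)\mapsto\langle[\xi,\eta],\zeta\rangle$ on $\mathfrak g^*\cong\mathfrak h$. Let $X$ be an affine scheme over $k$ with a $G$-action, given by a right coaction of $\mathcal O(G)$ on $\mathcal O(X)$, and let $a(x).g=g_{(0)}x(g_{(1)})$ for $x\in\mathfrak g$. A quasi-Poisson $G$-structure on $X$ is a family of bivectors $\pi_X^{\mathfrak h}$, indexed by the Lagrangian complements $\mathfrak h$, such that the action is compatible with $\pi_G^{\mathfrak h}$ and $\pi_X^{\mathfrak h}$, $\tfrac12[\pi_X^{\mathfrak h},\pi_X^{\mathfrak h}]=a(\varphi^{\mathfrak h})$ (that is, the Jacobiator $\{f,\{g,h\}\}+\{g,\{h,f\}\}+\{h,\{f,g\}\}$ is $a(\varphi^{\mathfrak h})(f,g,h)$), and $\pi_X^{\mathfrak h_2}=\pi_X^{\mathfrak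 h_1}-a(t)$ whenever $t\in\wedge^2\mathfrak g$ is the twist from $\mathfrak h_1$ to $\mathfrak h_2$, i.e. $p_{\mathfrak h_2}-p_{\mathfrak h_1}$ is the composite $\mathfrak d^*\to\mathfrak g^*\xrightarrow{-t}\mathfrak g$. A $G$-equivariant map $\mu\colon X\to D/G$, given by an equivariant algebra map $\mu^*\colon\mathcal O(D/G)\to\mathcal O(X)$, is a *classical moment map* if for some Lagrangian complement $\mathfrak h$ $$\{\mu^*f_1,f_2\}_{\mathfrak h}=\sum_i\mu^*(\tilde a(e_i).f_1)\cdot a(p_{\mathfrak h}(e^i)).f_2\qquad(*)$$ for all $f_1\in\mathcal O(D/G)$, $f_2\in\mathcal O(X)$. Let $\mathcal O_\hbar(D)$ be a coquasitriangular Hopf algebra and $\mathcal O_\hbar(G)$ an $\mathcal O_\hbar(D)$-coquasitriangular Hopf algebra, with structures $\mathbf r$ and $\mathbf r_G$, both flat over $\mathcal A$, which reduce modulo $\hbar$ to $\mathcal O(D)\to\mathcal O(G)$ with the trivial structures $\epsilon\otimes\epsilon$. Put $r=(\mathbf r-\epsilon\otimes\epsilon)/\hbar$, $r_G=(\mathbf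 r_G-\epsilon\otimes\epsilon)/\hbar$, and suppose that $r(a,b)+r(b,a)=c(a,b)$. Let $A_\hbar$ be an $\mathcal O_\hbar(G)$-comodule algebra, flat over $\mathcal A$, with an isomorphism $A_\hbar/\hbar\cong\mathcal O(X)$ of algebras and $G$-representations. Let $\mathcal F=\{d\in\mathcal O_\hbar(D): d_{(1)}|_G\otimes d_{(2)}=1\otimes d\}$. A *quantum moment map* is an algebra map $\mu_\hbar\colon\mathcal F\to A_\hbar$ of $\mathcal O_\hbar(G)$-comodules with $\mu_\hbar(x)\,\alpha=\mathbf r_G(x_{(1)},\alpha_{(1)})\,\alpha_{(0)}\,\mu_\hbar(x_{(0)})$ for all $x\in\mathcal F$, $\alpha\in A_\hbar$. **Theorem.** Let $\mu\colon X\to D/G$ be a $G$-equivariant map (given by $\mu^*$) and let $\mu_\hbar\colon\mathcal F\to A_\hbar$ be a quantum moment map which is $\mu^*$ modulo $\hbar$. Then: 1. $\mathfrak h=\{r_G(-,b): b\in\mathcal O(G)\}$ is a Lagrangian complement to $\mathfrak g$ in $\mathfrak d$; 2. $\{\alpha,\beta\}=(\alpha\beta-\beta\alpha)/\hbar$ defines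 a bivector $\pi$ on $X$, and the action of $G$ on $X$ is compatible with $\pi_G^{\mathfrak h}$ and $\pi$; 3. the moment map equation $(*)$ holds for $\mathfrak h$ and $\pi$, for all $f_2\in\mathcal O(X)$ and all $f_1\in\mathcal O(D/G)$ that lift to $\mathcal F$; 4. if $D/G$ is affine, then $(*)$ holds for $\mathfrak h$ and $\pi$ and all $f_1\in\mathcal O(D/G)$, $f_2\in\mathcal O(X)$. In particular, for every quasi-Poisson $G$-structure on $X$ whose bivector for the complement $\mathfrak h$ is $\pi$, the map $\mu$ is a classical moment map. -/

import Mathlib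

open scoped TensorProduct

noncomputable section

namespace QuantumMoment

/-! ## Comodule algebras, coinvariants and skew-pairings over a commutative ring `R` -/

/-- A right comodule algebra `A` over a bialgebra `H`: an algebra object in the monoidal category
of right `H`-comodules. -/
structure ComoduleAlgebra (R H A : Type*) [CommRing R] [Ring H] [Bialgebra R H]
    [Ring A] [Algebra R A] where
  /-- the coaction `a ↦ a₍₀₎ ⊗ a₍₁₎` -/
  coact : A →ₐ[R] A ⊗[R] H
  coassoc : ∀ a, TensorProduct.assoc R A H H (coact.toLinearMap.rTensor H (coact a)) =
    (Coalgebra.comul (R := R) (A := H)).lTensor A (coact a)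
  counit : ∀ a, TensorProduct.rid R A
    ((Coalgebra.counit (R := R) (A := H)).lTensor A (coact a)) = a

section Coaction

/-- For a bialgebra map `f : H → K`, the left `K`-coinvariants
`{h | f(h₍₁₎) ⊗ h₍₂₎ = 1 ⊗ h}` of `H`. The right adjoint `T^R` of the monoidal functor
`T : CoMod_H → CoMod_K` is the cotensor product `W ↦ W □_K H`, so this is the algebra `T^R(1)`;
seen as a `K`-comodule through `f` it is the algebra `𝓕 = T T^R(1)`. -/
def coinv {R H K : Type*} [CommRing R] [Ring H] [Bialgebra R H] [Ring K] [Bialgebra R K]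
    (f : H →ₐc[R] K) : Subalgebra R H :=
  AlgHom.equalizer
    ((Algebra.TensorProduct.map (f : H →ₐ[R] K) (AlgHom.id R H)).comp (Bialgebra.comulAlgHom R H))
    Algebra.TensorProduct.includeRight

variable {R H K : Type*} [CommRing R] [Ring H] [Bialgebra R H] [Ring K] [Bialgebra R K]
  (f : H →ₐc[R] K)

/-- `h ↦ f(h₍₁₎) ⊗ h₍₂₎ - 1 ⊗ h`, whose kernel is `coinv f`. -/
def coinvDefect : H →ₗ[R] K ⊗[R] H :=
  (TensorProduct.map (f : H →ₐ[R] K).toLinearMap LinearMap.id) ∘ₗ Coalgebra.comul -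
    TensorProduct.mk R K H 1

theorem coinvDefect_eq_zero_iff (x : H) : coinvDefect f x = 0 ↔ x ∈ coinv f := by
  rw [coinv, AlgHom.mem_equalizer, coinvDefect, LinearMap.sub_apply, sub_eq_zero]
  rfl

theorem exact_coinv :
    Function.Exact (Subalgebra.toSubmodule (coinv f)).subtype (coinvDefect f) := by
  intro x
  rw [coinvDefect_eq_zero_iff]
  simp

theorem coinvDefect_rTensor_comul (x : H) :
    (coinvDefect f).rTensor H (Coalgebra.comul (R := R) x) =
      (TensorProduct.assoc R K H H).symm
        ((Coalgebra.comul (R := R) (A := H)).lTensor K (coinvDefect f x)) := by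
  have key : ∀ t : H ⊗[R] H,
      ((TensorProduct.map (f : H →ₐ[R] K).toLinearMap LinearMap.id).rTensor H)
        ((TensorProduct.assoc R H H H).symm
          ((Coalgebra.comul (R := R) (A := H)).lTensor H t)) =
      (TensorProduct.assoc R K H H).symm
        ((Coalgebra.comul (R := R) (A := H)).lTensor K
          (TensorProduct.map (f : H →ₐ[R] K).toLinearMap LinearMap.id t)) := by
    intro t
    induction t with
    | zero => simp
    | add a b ha hb => simp only [map_add, ha, hb]
    | tmul a b =>
      simp only [LinearMap.lTensor_tmul, TensorProduct.map_tmul, LinearMap.id_apply]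
      generalize Coalgebra.comul (R := R) b = s
      induction s with
      | zero => simp
      | add a b ha hb => simp only [TensorProduct.tmul_add, map_add, ha, hb]
      | tmul b c => simp
  have key2 : ∀ t : H ⊗[R] H, ((TensorProduct.mk R K H 1).rTensor H) t =
      (TensorProduct.assoc R K H H).symm ((1 : K) ⊗ₜ[R] t) := by
    intro t
    induction t with
    | zero => simp
    | add a b ha hb => simp only [TensorProduct.tmul_add, map_add, ha, hb]
    | tmul a b => simp
  rw [coinvDefect, LinearMap.rTensor_sub, LinearMap.sub_apply, LinearMap.rTensor_comp,
    LinearMap.comp_apply, ← Coalgebra.coassoc_symm_apply, key, key2]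
  simp

theorem comul_mem_coinv [Module.Flat R H] (x : coinv f) :
    Coalgebra.comul (R := R) (x : H) ∈
      LinearMap.range ((coinv f).val.toLinearMap.rTensor H) := by
  have h := Module.Flat.rTensor_exact H (exact_coinv f) (Coalgebra.comul (R := R) (x : H))
  refine h.1 ?_
  rw [coinvDefect_rTensor_comul, (coinvDefect_eq_zero_iff f _).2 x.2]
  simp

theorem coinv_rTensor_injective [Module.Flat R H] :
    Function.Injective ((coinv f).val.toLinearMap.rTensor H) :=
  Module.Flat.rTensor_preserves_injective_linearMap _ Subtype.val_injective

/-- The right `H`-coaction on the coinvariants, i.e. the restriction of the comultiplication. -/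
def coinvCoact [Module.Flat R H] : coinv f →ₗ[R] coinv f ⊗[R] H :=
  (LinearEquiv.ofInjective _ (coinv_rTensor_injective f)).symm.toLinearMap ∘ₗ
    LinearMap.codRestrict (LinearMap.range ((coinv f).val.toLinearMap.rTensor H))
      (Coalgebra.comul ∘ₗ (coinv f).val.toLinearMap) (comul_mem_coinv f)

theorem rTensor_coinvCoact [Module.Flat R H] (x : coinv f) :
    (coinv f).val.toLinearMap.rTensor H (coinvCoact f x) = Coalgebra.comul (R := R) (x : H) := by
  have := LinearEquiv.apply_symm_apply (LinearEquiv.ofInjective _ (coinv_rTensor_injective f))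
    (LinearMap.codRestrict (LinearMap.range ((coinv f).val.toLinearMap.rTensor H))
      (Coalgebra.comul ∘ₗ (coinv f).val.toLinearMap) (comul_mem_coinv f) x)
  exact congrArg Subtype.val this

end Coaction

section Pairings

variable {R : Type*} [CommRing R]

/-- `(u₁ ⊗ u₂, v₁ ⊗ v₂) ↦ r(u₁, v₁) m(u₂, v₂)`. -/
def pairFirst {U U' V V' W : Type*} [AddCommGroup U] [Module R U] [AddCommGroup U'] [Module R U']
    [AddCommGroup V] [Module R V] [AddCommGroup V'] [Module R V'] [AddCommGroup W] [Module R W]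
    (r : U →ₗ[R] V →ₗ[R] R) (m : U' →ₗ[R] V' →ₗ[R] W) (s : U ⊗[R] U') (t : V ⊗[R] V') : W :=
  TensorProduct.lid R W (TensorProduct.map₂ r m s t)

/-- `(u₁ ⊗ u₂, v₁ ⊗ v₂) ↦ r(u₂, v₂) m(u₁, v₁)`. -/
def pairSecond {U U' V V' W : Type*} [AddCommGroup U] [Module R U] [AddCommGroup U'] [Module R U']
    [AddCommGroup V] [Module R V] [AddCommGroup V'] [Module R V'] [AddCommGroup W] [Module R W]
    (m : U →ₗ[R] V →ₗ[R] W) (r : U' →ₗ[R] V' →ₗ[R] R) (s : U ⊗[R] U') (t : V ⊗[R] V') : W :=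
  TensorProduct.rid R W (TensorProduct.map₂ m r s t)

variable {H K : Type*} [Ring H] [HopfAlgebra R H] [Ring K] [HopfAlgebra R K]

/-- A skew-pairing `r : H ⊗ K → R` of Hopf algebras. (It is automatically convolution invertible,
with inverse `r(S h, k)`.) -/
structure IsSkewPairing (r : H →ₗ[R] K →ₗ[R] R) : Prop where
  /-- `r(ab, c) = r(a, c₍₁₎) r(b, c₍₂₎)` -/
  mul_left : ∀ a b c, r (a * b) c =
    LinearMap.mul' R R (TensorProduct.map (r a) (r b) (Coalgebra.comul c))
  /-- `r(a, bc) = r(a₍₁₎, c) r(a₍₂₎, b)` -/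
  mul_right : ∀ a b c, r a (b * c) =
    LinearMap.mul' R R (TensorProduct.map (r.flip c) (r.flip b) (Coalgebra.comul a))
  one_left : ∀ c, r 1 c = Coalgebra.counit c
  one_right : ∀ a, r a 1 = Coalgebra.counit a

/-- A coquasitriangular structure on a Hopf algebra `H`. -/
structure IsCoquasitriangular (r : H →ₗ[R] H →ₗ[R] R) : Prop where
  skew : IsSkewPairing r
  /-- `r(a₍₁₎, b₍₁₎) a₍₂₎ b₍₂₎ = r(a₍₂₎, b₍₂₎) b₍₁₎ a₍₁₎` -/
  rmatrix : ∀ a b : H,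
    pairFirst r (LinearMap.mul R H) (Coalgebra.comul a) (Coalgebra.comul b) =
      pairSecond (LinearMap.mul R H).flip r (Coalgebra.comul a) (Coalgebra.comul b)

/-- For a Hopf algebra map `f : H → K` and a coquasitriangular structure `rH` on `H`, an
`H`-coquasitriangular structure on `K`. -/
structure IsRelCoquasitriangular (f : H →ₐc[R] K) (rH : H →ₗ[R] H →ₗ[R] R)
    (rK : H →ₗ[R] K →ₗ[R] R) : Prop where
  skew : IsSkewPairing rK
  compat : ∀ a b, rK a (f b) = rH a b
  /-- `rK(d₍₁₎, h₍₁₎) f(d₍₂₎) h₍₂₎ = rK(d₍₂₎, h₍₂₎) h₍₁₎ f(d₍₁₎)` -/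
  rmatrix : ∀ (d : H) (h : K),
    pairFirst rK ((LinearMap.mul R K) ∘ₗ (f : H →ₐ[R] K).toLinearMap)
        (Coalgebra.comul d) (Coalgebra.comul h) =
      pairSecond ((LinearMap.mul R K).flip ∘ₗ (f : H →ₐ[R] K).toLinearMap) rK
        (Coalgebra.comul d) (Coalgebra.comul h)

variable {A : Type*} [Ring A] [Algebra R A]

/-- The isomorphism `τ : 𝓕 ⊗ A → A ⊗ 𝓕`, `x ⊗ a ↦ rK(x₍₁₎, a₍₁₎) a₍₀₎ ⊗ x₍₀₎`, of the
`CoMod_H`-monoidal category `CoMod_K`, where `x₍₀₎ ⊗ x₍₁₎ ∈ 𝓕 ⊗ H` and `a₍₀₎ ⊗ a₍₁₎ ∈ A ⊗ K`. -/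
def fieldGoal [Module.Flat R H] (f : H →ₐc[R] K) (rK : H →ₗ[R] K →ₗ[R] R)
    (ρ : ComoduleAlgebra R K A) (x : coinv f) (a : A) : A ⊗[R] coinv f :=
  pairSecond (TensorProduct.mk R A (coinv f)).flip rK (coinvCoact f x) (ρ.coact a)

/-- A quantum moment map `μ : 𝓕 → A` for the quantum Manin pair `(CoMod_H, CoMod_K)`: an algebra
map in `CoMod_K` such that `m ∘ (μ ⊗ id) = m ∘ (id ⊗ μ) ∘ τ` on `𝓕 ⊗ A`. -/
structure IsQuantumMomentMap [Module.Flat R H] (f : H →ₐc[R] K) (rK : H →ₗ[R] K →ₗ[R] R)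
    (ρ : ComoduleAlgebra R K A) (μ : coinv f →ₐ[R] A) : Prop where
  colinear : ∀ x, ρ.coact (μ x) =
    TensorProduct.map μ.toLinearMap (f : H →ₐ[R] K).toLinearMap (coinvCoact f x)
  moment : ∀ x a, μ x * a =
    LinearMap.mul' R A (μ.toLinearMap.lTensor A (fieldGoal f rK ρ x a))

end Pairings

/-! ## Group pairs and their Lie algebras -/

section Lie

variable {k : Type*} [CommRing k]

/-- The Lie algebra of the affine group scheme `Spec O`: derivations `O → k` at the identity. -/
def lieAlg (k O : Type*) [CommRing k] [CommRing O] [Bialgebra k O] :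
    Submodule k (Module.Dual k O) where
  carrier := {x | ∀ a b, x (a * b) =
    Coalgebra.counit (R := k) a * x b + x a * Coalgebra.counit (R := k) b}
  add_mem' {x y} hx hy a b := by
    simp only [LinearMap.add_apply, hx a b, hy a b]; ring
  zero_mem' a b := by simp
  smul_mem' r x hx a b := by
    simp only [LinearMap.smul_apply, hx a b, smul_eq_mul]; ring

/-- The cotangent space `𝔪 / 𝔪²` of `Spec O` at the identity. -/
abbrev CotangentAtOne (k O : Type*) [CommRing k] [CommRing O] [Bialgebra k O] : Type _ :=
  (RingHom.ker (Bialgebra.counitAlgHom k O)).Cotangent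

variable {O O' : Type*} [CommRing O] [Bialgebra k O] [CommRing O'] [Bialgebra k O']

/-- The convolution product `(x * y)(a) = x(a₍₁₎) y(a₍₂₎)`. -/
def conv (x y : Module.Dual k O) : Module.Dual k O :=
  LinearMap.mul' k k ∘ₗ TensorProduct.map x y ∘ₗ Coalgebra.comul

theorem map_lieAlg_mul (x y : lieAlg k O) (s t : O ⊗[k] O) :
    LinearMap.mul' k k (TensorProduct.map x.1 y.1 (s * t)) =
      LinearMap.mul' k k (TensorProduct.map Coalgebra.counit Coalgebra.counit s) *
          LinearMap.mul' k k (TensorProduct.map x.1 y.1 t) +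
        LinearMap.mul' k k (TensorProduct.map Coalgebra.counit y.1 s) *
          LinearMap.mul' k k (TensorProduct.map x.1 Coalgebra.counit t) +
        LinearMap.mul' k k (TensorProduct.map x.1 Coalgebra.counit s) *
          LinearMap.mul' k k (TensorProduct.map Coalgebra.counit y.1 t) +
        LinearMap.mul' k k (TensorProduct.map x.1 y.1 s) *
          LinearMap.mul' k k (TensorProduct.map Coalgebra.counit Coalgebra.counit t) := by
  induction s with
  | zero => simp
  | add s s' hs hs' => simp only [add_mul, map_add, hs, hs']; ring
  | tmul a a' =>
    induction t with
    | zero => simp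
    | add t t' ht ht' => simp only [mul_add, map_add, ht, ht']; ring
    | tmul b b' =>
      simp only [Algebra.TensorProduct.tmul_mul_tmul, TensorProduct.map_tmul,
        LinearMap.mul'_apply, x.2 a b, y.2 a' b']
      ring

theorem conv_mul (x y : lieAlg k O) (a b : O) :
    conv x.1 y.1 (a * b) = Coalgebra.counit (R := k) a * conv x.1 y.1 b + y.1 a * x.1 b +
      x.1 a * y.1 b + conv x.1 y.1 a * Coalgebra.counit (R := k) b := by
  have h1 : ∀ (z : Module.Dual k O) (c : O), LinearMap.mul' k k
      (TensorProduct.map z Coalgebra.counit (Coalgebra.comul (R := k) c)) = z c := by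
    intro z c
    have e : TensorProduct.map z (Coalgebra.counit (R := k) (A := O)) =
        TensorProduct.map z LinearMap.id ∘ₗ (Coalgebra.counit (R := k) (A := O)).lTensor O := by
      rw [LinearMap.lTensor, ← TensorProduct.map_comp, LinearMap.comp_id, LinearMap.id_comp]
    rw [e, LinearMap.comp_apply, Coalgebra.lTensor_counit_comul, TensorProduct.map_tmul,
      LinearMap.mul'_apply, LinearMap.id_apply, mul_one]
  have h2 : ∀ (z : Module.Dual k O) (c : O), LinearMap.mul' k k
      (TensorProduct.map Coalgebra.counit z (Coalgebra.comul (R := k) c)) = z c := by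
    intro z c
    have e : TensorProduct.map (Coalgebra.counit (R := k) (A := O)) z =
        TensorProduct.map LinearMap.id z ∘ₗ (Coalgebra.counit (R := k) (A := O)).rTensor O := by
      rw [LinearMap.rTensor, ← TensorProduct.map_comp, LinearMap.comp_id, LinearMap.id_comp]
    rw [e, LinearMap.comp_apply, Coalgebra.rTensor_counit_comul, TensorProduct.map_tmul,
      LinearMap.mul'_apply, LinearMap.id_apply, one_mul]
  simp only [conv, LinearMap.comp_apply, Bialgebra.comul_mul, map_lieAlg_mul, h1, h2]

theorem conv_add_left (x x' y : Module.Dual k O) : conv (x + x') y = conv x y + conv x' y := by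
  simp only [conv, TensorProduct.map_add_left, LinearMap.add_comp, LinearMap.comp_add]

theorem conv_add_right (x y y' : Module.Dual k O) : conv x (y + y') = conv x y + conv x y' := by
  simp only [conv, TensorProduct.map_add_right, LinearMap.add_comp, LinearMap.comp_add]

theorem conv_smul_left (r : k) (x y : Module.Dual k O) : conv (r • x) y = r • conv x y := by
  simp only [conv, TensorProduct.map_smul_left, LinearMap.smul_comp, LinearMap.comp_smul]

theorem conv_smul_right (r : k) (x y : Module.Dual k O) : conv x (r • y) = r • conv x y := by
  simp only [conv, TensorProduct.map_smul_right, LinearMap.smul_comp, LinearMap.comp_smul]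

/-- The Lie bracket `[x, y] = x * y - y * x` of the Lie algebra of `Spec O`. -/
def lieBracket : lieAlg k O →ₗ[k] lieAlg k O →ₗ[k] lieAlg k O :=
  LinearMap.mk₂ k
    (fun x y => ⟨conv x.1 y.1 - conv y.1 x.1, fun a b => by
      simp only [LinearMap.sub_apply, conv_mul]; ring⟩)
    (fun x x' y => Subtype.ext <| by
      simp only [Submodule.coe_add, conv_add_left, conv_add_right]; abel)
    (fun r x y => Subtype.ext <| by
      simp only [Submodule.coe_smul, conv_smul_left, conv_smul_right, smul_sub])
    (fun x y y' => Subtype.ext <| by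
      simp only [Submodule.coe_add, conv_add_left, conv_add_right]; abel)
    (fun r x y => Subtype.ext <| by
      simp only [Submodule.coe_smul, conv_smul_left, conv_smul_right, smul_sub])

/-- A function `a ∈ O` as a linear form `x ↦ x(a)` on the Lie algebra (its differential at the
identity). -/
def differentialAtOne : O →ₗ[k] Module.Dual k (lieAlg k O) :=
  (lieAlg k O).subtype.dualMap ∘ₗ Module.Dual.eval k O

/-- The map of Lie algebras induced by `f : O → O'`, i.e. by a homomorphism
`Spec O' → Spec O`. -/
def lieMap (f : O →ₐc[k] O') : lieAlg k O' →ₗ[k] lieAlg k O :=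
  LinearMap.restrict ((f : O →ₐ[k] O').toLinearMap.dualMap) (fun x hx a b => by
    have h : ∀ c, Coalgebra.counit (R := k) (f c) = Coalgebra.counit (R := k) c := fun c =>
      CoalgHomClass.counit_comp_apply f c
    have := hx (f a) (f b)
    simpa [h] using this)

theorem lieMap_injective (f : O →ₐc[k] O') (hf : Function.Surjective f) :
    Function.Injective (lieMap f) := by
  intro x y hxy
  ext b
  obtain ⟨a, rfl⟩ := hf b
  exact congrArg (fun z : lieAlg k O => z.1 a) hxy

/-- For `c = ∑ c' ⊗ c'' ∈ V ⊗ V`, the map `V* → V`, `ξ ↦ ∑ ξ(c') c''`. -/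
def sharp {V : Type*} [AddCommMonoid V] [Module k V] (c : V ⊗[k] V) : Module.Dual k V →ₗ[k] V :=
  (TensorProduct.lid k V).toLinearMap ∘ₗ LinearMap.applyₗ c ∘ₗ LinearMap.rTensorHom V

/-- `W ⊆ V` is Lagrangian for a nondegenerate `c ∈ Sym²(V)`: the isomorphism `V* ≅ V` given by
`c` maps the annihilator of `W` onto `W`, i.e. `W` is its own orthogonal. -/
def IsLagrangian {V : Type*} [AddCommMonoid V] [Module k V] (c : V ⊗[k] V)
    (W : Submodule k V) : Prop :=
  W.dualAnnihilator.map (sharp c) = W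

/-- The bilinear functional on `O` given by `c ∈ 𝔡 ⊗ 𝔡`: `∑ c' ⊗ c''` is sent to
`(a, b) ↦ ∑ c'(a) c''(b)`. -/
def bilinOf (c : lieAlg k O ⊗[k] lieAlg k O) : O →ₗ[k] O →ₗ[k] k :=
  (lieAlg k O).subtype ∘ₗ sharp c ∘ₗ differentialAtOne

end Lie

/-- A group pair `(D, G)` of affine group schemes with coordinate rings `OD`, `OG`. -/
structure GroupPair (k OD OG : Type*) [CommRing k] [CommRing OD] [HopfAlgebra k OD]
    [CommRing OG] [HopfAlgebra k OG] where
  /-- restriction of functions from `D` to `G` -/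
  res : OD →ₐc[k] OG
  /-- `G ⊆ D` is a closed subgroup -/
  res_surjective : Function.Surjective res
  /-- the element of `Sym²(𝔡)^D` -/
  c : lieAlg k OD ⊗[k] lieAlg k OD
  symm : TensorProduct.comm k _ _ c = c
  /-- `D`-invariance: `c` defines the same left- and right-invariant tensor field on `D`, i.e.
  `c(a₍₂₎, b₍₂₎) a₍₁₎ b₍₁₎ = c(a₍₁₎, b₍₁₎) a₍₂₎ b₍₂₎` -/
  invariant : ∀ a b : OD,
    pairSecond (LinearMap.mul k OD) (bilinOf c) (Coalgebra.comul a) (Coalgebra.comul b) =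
      pairFirst (bilinOf c) (LinearMap.mul k OD) (Coalgebra.comul a) (Coalgebra.comul b)
  nondegenerate : Function.Bijective (sharp c)
  lagrangian : IsLagrangian c (LinearMap.range (lieMap res))

section Classical

variable {k OD OG OX : Type*} [CommRing k] [CommRing OD] [HopfAlgebra k OD]
  [CommRing OG] [HopfAlgebra k OG] [CommRing OX] [Algebra k OX]

/-- A Lagrangian complement `𝔥 ⊆ 𝔡` to `𝔤 ⊆ 𝔡` (not assumed to be a Lie subalgebra). -/
structure LagrangianComplement (P : GroupPair k OD OG) where
  carrier : Submodule k (lieAlg k OD)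
  lagrangian : IsLagrangian P.c carrier
  isCompl : IsCompl (LinearMap.range (lieMap P.res)) carrier

namespace LagrangianComplement

variable {P : GroupPair k OD OG} (h : LagrangianComplement P)

/-- `p_𝔥 : 𝔡* ≅ 𝔡 → 𝔤`, the projection along `𝔥`. -/
def proj : Module.Dual k (lieAlg k OD) →ₗ[k] lieAlg k OG :=
  (LinearEquiv.ofInjective (lieMap P.res)
      (lieMap_injective P.res P.res_surjective)).symm.toLinearMap ∘ₗ
    Submodule.projectionOnto (E := lieAlg k OD) _ _ h.isCompl ∘ₗ sharp P.c

/-- The canonical `r`-matrix `r_𝔥 = ∑ eᵢ ⊗ p_𝔥(eⁱ) ∈ 𝔡 ⊗ 𝔤` as a bilinear functional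
`(a, b) ↦ ∑ eᵢ(a) p_𝔥(eⁱ)(b)` on `OD × OG`. -/
def rMatrix : OD →ₗ[k] OG →ₗ[k] k :=
  (lieAlg k OG).subtype ∘ₗ h.proj ∘ₗ differentialAtOne

theorem rMatrix_mul (a a' : OD) (b : OG) : h.rMatrix (a * a') b =
    Coalgebra.counit (R := k) a * h.rMatrix a' b + h.rMatrix a b * Coalgebra.counit (R := k) a' := by
  have : differentialAtOne (k := k) (a * a') = Coalgebra.counit (R := k) a • differentialAtOne a' +
      Coalgebra.counit (R := k) a' • differentialAtOne (k := k) a := by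
    ext x
    have := x.2 a a'
    simp only [differentialAtOne, LinearMap.comp_apply, LinearMap.dualMap_apply,
      Module.Dual.eval_apply, LinearMap.add_apply, LinearMap.smul_apply, smul_eq_mul,
      Submodule.subtype_apply, this]
    ring
  simp only [rMatrix, LinearMap.comp_apply, this, map_add, map_smul, LinearMap.add_apply,
    LinearMap.smul_apply, smul_eq_mul]
  ring

/-- `b ↦ r_𝔥(-, b)`; this is the isomorphism `𝔤* ≅ 𝔥` given by the pairing on `𝔡`, composed with
the differential at the identity `OG → 𝔤*`. -/
def dualEmbedding : OG →ₗ[k] lieAlg k OD :=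
  LinearMap.codRestrict (lieAlg k OD) h.rMatrix.flip (fun b a a' => h.rMatrix_mul a a' b)

end LagrangianComplement

/-- The nondegenerate pairing `⟨x, -⟩` on `𝔡` inverse to `c`. -/
def GroupPair.flat (P : GroupPair k OD OG) :
    lieAlg k OD →ₗ[k] Module.Dual k (lieAlg k OD) :=
  (LinearEquiv.ofBijective (sharp P.c) P.nondegenerate).symm.toLinearMap

/-- The trivector `φ^𝔥 ∈ ∧³(𝔤)` of the quasi-triple `(D, G, 𝔥)`: for `ξ, η, ζ ∈ 𝔤* ≅ 𝔥` it is
`⟨[ξ, η], ζ⟩`. It is given here as a trilinear functional on `OG` through `OG → 𝔤*`. -/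
def LagrangianComplement.trivector {P : GroupPair k OD OG} (h : LagrangianComplement P) :
    OG →ₗ[k] OG →ₗ[k] OG →ₗ[k] k :=
  (lieBracket.compl₁₂ h.dualEmbedding h.dualEmbedding).compr₂
    (h.dualEmbedding.dualMap ∘ₗ P.flat)

/-- The bracket of the quasi-Poisson structure `π_G^𝔥` on `G`: the biderivation with
`{f(d), b} = r_𝔥(d₍₂₎, b₍₂₎) b₍₁₎ f(d₍₁₎) - r_𝔥(d₍₁₎, b₍₁₎) f(d₍₂₎) b₍₂₎`, where `f : OD → OG` is
the restriction (being surjective, this determines the bracket). -/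
def IsGroupBracket {P : GroupPair k OD OG} (h : LagrangianComplement P)
    (πG : OG →ₗ[k] OG →ₗ[k] OG) : Prop :=
  ∀ (d : OD) (b : OG), πG (P.res d) b =
    pairSecond ((LinearMap.mul k OG) ∘ₗ (P.res : OD →ₐ[k] OG).toLinearMap) h.rMatrix
        (Coalgebra.comul d) (Coalgebra.comul b) -
      pairFirst h.rMatrix ((LinearMap.mul k OG) ∘ₗ (P.res : OD →ₐ[k] OG).toLinearMap)
        (Coalgebra.comul d) (Coalgebra.comul b)

/-- A bivector on the affine scheme `X = Spec OX`: an alternating biderivation of `OX`. -/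
structure Bivector (k OX : Type*) [CommRing k] [CommRing OX] [Algebra k OX] where
  bracket : OX →ₗ[k] OX →ₗ[k] OX
  alternating : ∀ f, bracket f f = 0
  leibniz : ∀ f g g', bracket f (g * g') = bracket f g * g' + g * bracket f g'

/-- The infinitesimal action of `x ∈ O(G)*` on a comodule: `f ↦ f₍₀₎ x(f₍₁₎)`. -/
def infAct {M : Type*} [AddCommGroup M] [Module k M] {O : Type*} [AddCommGroup O] [Module k O]
    (δ : M →ₗ[k] M ⊗[k] O) (f : M) : Module.Dual k O →ₗ[k] M :=
  (TensorProduct.rid k M).toLinearMap ∘ₗ LinearMap.applyₗ (δ f) ∘ₗ LinearMap.lTensorHom M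

/-- For a linear map `L : O(G) → OX` the contraction `f₍₀₎ L(f₍₁₎)`. -/
def contract (ρ : ComoduleAlgebra k OG OX) (f : OX) : (OG →ₗ[k] OX) →ₗ[k] OX :=
  LinearMap.mul' k OX ∘ₗ LinearMap.applyₗ (ρ.coact f) ∘ₗ LinearMap.lTensorHom OX

/-- The trivector field `a(φ)` on `X`:
`a(φ)(f, g, h) = f₍₀₎ g₍₀₎ h₍₀₎ φ(f₍₁₎, g₍₁₎, h₍₁₎)`. -/
def trivectorAct (ρ : ComoduleAlgebra k OG OX) (φ : OG →ₗ[k] OG →ₗ[k] OG →ₗ[k] k)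
    (f₁ f₂ f₃ : OX) : OX :=
  contract ρ f₁ (contract ρ f₂ ∘ₗ φ.compr₂ (infAct ρ.coact.toLinearMap f₃))

/-- The bivector field `a(t)` on `X`: for `t = ∑ t' ⊗ t'' ∈ 𝔤 ⊗ 𝔤`,
`a(t)(f, g) = ∑ (a(t').f) (a(t'').g)`. -/
def bivectorAct (ρ : ComoduleAlgebra k OG OX) (t : lieAlg k OG ⊗[k] lieAlg k OG)
    (f₁ f₂ : OX) : OX :=
  LinearMap.mul' k OX (TensorProduct.map
    (infAct ρ.coact.toLinearMap f₁ ∘ₗ (lieAlg k OG).subtype)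
    (infAct ρ.coact.toLinearMap f₂ ∘ₗ (lieAlg k OG).subtype) t)

/-- The action map `G × X → X` is compatible with the bivectors `π_G^𝔥` and `π_X`: the coaction
intertwines the bracket on `OX` with the product bracket on `OX ⊗ OG`,
`ρ{f, g} = {f₍₀₎, g₍₀₎} ⊗ f₍₁₎ g₍₁₎ + f₍₀₎ g₍₀₎ ⊗ {f₍₁₎, g₍₁₎}`. -/
def ActionCompatible {P : GroupPair k OD OG} (h : LagrangianComplement P)
    (ρ : ComoduleAlgebra k OG OX) (π : Bivector k OX) : Prop :=
  ∃ πG : OG →ₗ[k] OG →ₗ[k] OG, IsGroupBracket h πG ∧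
    ∀ f g, ρ.coact (π.bracket f g) =
      TensorProduct.map₂ π.bracket (LinearMap.mul k OG) (ρ.coact f) (ρ.coact g) +
        TensorProduct.map₂ (LinearMap.mul k OX) πG (ρ.coact f) (ρ.coact g)

/-- `t ∈ ∧²(𝔤)` is the twist from `𝔥₁` to `𝔥₂`: `p_{𝔥₂} - p_{𝔥₁}` is the composite
`𝔡* → 𝔤* → 𝔤` of the restriction and `-t`. -/
def IsTwist {P : GroupPair k OD OG} (h₁ h₂ : LagrangianComplement P)
    (t : lieAlg k OG ⊗[k] lieAlg k OG) : Prop :=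
  TensorProduct.comm k _ _ t + t = 0 ∧
    ∀ ξ, h₂.proj ξ - h₁.proj ξ = -(sharp t ((lieMap P.res).dualMap ξ))

/-- The structure of a quasi-Poisson `G`-variety on `X` for the group pair `(D, G)`: a family of
bivectors indexed by the Lagrangian complements. -/
structure QuasiPoisson (P : GroupPair k OD OG) (ρ : ComoduleAlgebra k OG OX) where
  bivector : LagrangianComplement P → Bivector k OX
  compatible : ∀ h, ActionCompatible h ρ (bivector h)
  /-- `½ [π^𝔥, π^𝔥] = a(φ^𝔥)`: the Jacobiator is the trivector `a(φ^𝔥)` -/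
  jacobiator : ∀ h f₁ f₂ f₃,
    (bivector h).bracket f₁ ((bivector h).bracket f₂ f₃) +
      (bivector h).bracket f₂ ((bivector h).bracket f₃ f₁) +
      (bivector h).bracket f₃ ((bivector h).bracket f₁ f₂) =
    trivectorAct ρ h.trivector f₁ f₂ f₃
  /-- `π^{𝔥₂} = π^{𝔥₁} - a(t)` -/
  twist : ∀ h₁ h₂ t, IsTwist h₁ h₂ t → ∀ f₁ f₂,
    (bivector h₂).bracket f₁ f₂ = (bivector h₁).bracket f₁ f₂ - bivectorAct ρ t f₁ f₂

/-- `𝒪(D/G)`, as a right `O(D)`-comodule algebra. -/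
abbrev GroupPair.quotientAlgebra (P : GroupPair k OD OG) : Subalgebra k OD := coinv P.res

/-- `D/G` is affine: the orbit map `D → Spec 𝒪(D/G)` of the base point is faithfully flat, and its
fibre over the base point is `G`. -/
def GroupPair.AffineQuotient (P : GroupPair k OD OG) : Prop :=
  Module.FaithfullyFlat P.quotientAlgebra OD ∧
    RingHom.ker P.res = Ideal.span {b | b ∈ P.quotientAlgebra ∧ Coalgebra.counit (R := k) b = 0}

variable [Module.Flat k OD]

/-- `G`-equivariance of `μ : X → D/G`. -/
def IsEquivariant (P : GroupPair k OD OG) (ρ : ComoduleAlgebra k OG OX)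
    (μ : P.quotientAlgebra →ₐ[k] OX) : Prop :=
  ∀ f, ρ.coact (μ f) =
    TensorProduct.map μ.toLinearMap (P.res : OD →ₐ[k] OG).toLinearMap (coinvCoact P.res f)

/-- The moment map equation
`{μ^* f₁, f₂}_𝔥 = ∑ᵢ μ^*(ã(eᵢ).f₁) · a(p_𝔥(eⁱ)).f₂` at `f₁ ∈ 𝒪(D/G)`, `f₂ ∈ 𝒪(X)`, for a basis
`eᵢ` of `𝔡` with dual basis `eⁱ`. -/
def MomentEquation {P : GroupPair k OD OG} (h : LagrangianComplement P)
    (ρ : ComoduleAlgebra k OG OX) (π : Bivector k OX) (μ : P.quotientAlgebra →ₐ[k] OX)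
    (f₁ : P.quotientAlgebra) (f₂ : OX) : Prop :=
  ∀ (n : ℕ) (e : Module.Basis (Fin n) k (lieAlg k OD)),
    π.bracket (μ f₁) f₂ = ∑ i, μ (infAct (coinvCoact P.res) f₁ (e i).1) *
      infAct ρ.coact.toLinearMap f₂ (h.proj (e.coord i)).1

/-- A (classical) moment map `μ : X → D/G` for a quasi-Poisson `G`-variety `X`. -/
def IsMomentMap {P : GroupPair k OD OG} {ρ : ComoduleAlgebra k OG OX} (π : QuasiPoisson P ρ)
    (μ : P.quotientAlgebra →ₐ[k] OX) : Prop :=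
  IsEquivariant P ρ μ ∧
    ∃ h : LagrangianComplement P, ∀ f₁ f₂, MomentEquation h ρ (π.bivector h) μ f₁ f₂

end Classical

/-! ## First-order quantizations, over `k[ħ]/ħ²` (the dual numbers) -/

section Quantum

/-- The ring map `k[ħ]/ħ² → k`. -/
abbrev modHbar (k : Type*) [CommRing k] : DualNumber k →+* k :=
  (TrivSqZeroExt.fstHom k k k).toRingHom

/-- An isomorphism of algebras `A / ħ ≅ B`, given as the composite `A → A / ħ ≅ B`. -/
structure AlgReduction (k A B : Type*) [CommRing k] [Ring A] [Algebra (DualNumber k) A]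
    [Ring B] [Algebra k B] where
  map : A →ₛₗ[modHbar k] B
  map_one : map 1 = 1
  map_mul : ∀ a a', map (a * a') = map a * map a'
  surjective : Function.Surjective map
  ker : ∀ a, map a = 0 ↔ ∃ a', a = (DualNumber.eps : DualNumber k) • a'

/-- An isomorphism of Hopf algebras `A / ħ ≅ B`. -/
structure HopfReduction (k A B : Type*) [CommRing k] [Ring A] [HopfAlgebra (DualNumber k) A]
    [Ring B] [HopfAlgebra k B] extends AlgReduction k A B where
  comul : ∀ a, Coalgebra.comul (R := k) (map a) =
    TensorProduct.map map map (Coalgebra.comul (R := DualNumber k) a)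
  counit : ∀ a, Coalgebra.counit (R := k) (map a) =
    modHbar k (Coalgebra.counit (R := DualNumber k) a)

/-- The coefficient of `ħ` of `r - ε ⊗ ε`. When `r = ε ⊗ ε` modulo `ħ`, this is the value of
`(r - ε ⊗ ε) / ħ`. -/
def classicalR {k H K : Type*} [CommRing k] [Ring H] [HopfAlgebra (DualNumber k) H]
    [Ring K] [HopfAlgebra (DualNumber k) K]
    (r : H →ₗ[DualNumber k] K →ₗ[DualNumber k] DualNumber k) (a : H) (b : K) : k :=
  TrivSqZeroExt.snd (r a b -
    Coalgebra.counit (R := DualNumber k) a * Coalgebra.counit (R := DualNumber k) b)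

/-- A first-order quantization of the group pair `(D, G)`: a coquasitriangular Hopf algebra
`HD = 𝒪_ħ(D)` and an `HD`-coquasitriangular Hopf algebra `HG = 𝒪_ħ(G)` (flatness is a separate
assumption) reducing to `O(D)`, `O(G)` with the trivial structures `ε ⊗ ε` modulo `ħ`, such that
the symmetric part of the classical limit `r` of the coquasitriangular structure is `c`. -/
structure Quantization {k OD OG : Type*} [CommRing k] [CommRing OD] [HopfAlgebra k OD]
    [CommRing OG] [HopfAlgebra k OG] (P : GroupPair k OD OG) (HD HG : Type*)
    [Ring HD] [HopfAlgebra (DualNumber k) HD] [Ring HG] [HopfAlgebra (DualNumber k) HG] where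
  res : HD →ₐc[DualNumber k] HG
  rD : HD →ₗ[DualNumber k] HD →ₗ[DualNumber k] DualNumber k
  rG : HD →ₗ[DualNumber k] HG →ₗ[DualNumber k] DualNumber k
  coquasitriangular : IsCoquasitriangular rD
  relCoquasitriangular : IsRelCoquasitriangular res rD rG
  redD : HopfReduction k HD OD
  redG : HopfReduction k HG OG
  red_res : ∀ a, redG.map (res a) = P.res (redD.map a)
  red_rD : ∀ a b, modHbar k (rD a b) =
    Coalgebra.counit (R := k) (redD.map a) * Coalgebra.counit (R := k) (redD.map b)
  red_rG : ∀ a b, modHbar k (rG a b) =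
    Coalgebra.counit (R := k) (redD.map a) * Coalgebra.counit (R := k) (redG.map b)
  /-- `r(a, b) + r(b, a) = c(a, b)` -/
  symmetric_part : ∀ a b, classicalR rD a b + classicalR rD b a =
    bilinOf P.c (redD.map a) (redD.map b)

/-- `π` is the bracket `{f, g} = (f g - g f) / ħ` on `OX` induced by the product of `A`. -/
def IsClassicalLimit {k A OX : Type*} [CommRing k] [Ring A] [Algebra (DualNumber k) A]
    [CommRing OX] [Algebra k OX] (red : AlgReduction k A OX) (π : Bivector k OX) : Prop :=
  ∀ a b c : A, red.map c = π.bracket (red.map a) (red.map b) →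
    a * b - b * a = (DualNumber.eps : DualNumber k) • c

end Quantum

end QuantumMoment

end

/-!
Everything takes place to first order in `ħ`. In a flat module `M` over the dual numbers, with
reduction `B = M / ħ`, multiplication by `ħ` is an injection `B → M` (`IsReduction.hbar`), so an
identity in `B` can be checked after applying it to lifts and multiplying by `ħ`. This is compatible
with tensor products (`IsReduction.tensor`), and it turns every bilinear map which vanishes modulo
`ħ` into a bilinear map of the reductions (`exists_bilin_of_red_eq_zero`): the classical `r`-matrix
`r` and the brackets of `A` and of `𝒪_ħ(G)` arise in this way.

*The complement.* The skew-pairing axioms make `r` a biderivation at the identity, i.e. an element of `𝔡 ⊗ 𝔤`, and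
its symmetric part is `c`. As every linear form on `𝔡` is the differential `da` of a function `a`
(`differentialAtOne_surjective`), every element of `𝔡` is `c(da) = r(a, -) + r(-, a)`. The first
summand lies in `𝔤`, and if `c(da)` lies in `𝔤`, then `da` annihilates `𝔤` because `𝔤` is Lagrangian,
so the second summand vanishes. Hence this is the decomposition along `𝔤` and `𝔥 = {r(-, b)}`; the
same identity shows that `𝔥` is Lagrangian with `r_𝔥 = r` (`exists_lagrangianComplement`).

*Compatibility and the moment map equation.* The `ħ`-coefficient of the `R`-matrix relation says that
`π_G^𝔥` is the commutator bracket of `𝒪_ħ(G)` (`isGroupBracket_of_commutator`), that of the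
multiplicativity of the coaction is the compatibility of the action
(`actionCompatible_of_commutator`), and that of the quantum moment map equation is the classical one,
for functions that lift to `𝓕` (`bracket_moment`, `momentEquation_of_pairing`).

*Lifting.* For `f₁ ∈ 𝒪(D/G)` with a lift `y ∈ 𝒪_ħ(D)`, the defect `y₍₁₎|_G ⊗ y₍₂₎ - 1 ⊗ y` is `ħ z`
with `z` a 1-cocycle of the cobar complex of the `𝒪(G)`-comodule `𝒪(D)`; if `z` is the coboundary of
`w`, then `y - ħ w` is a lift in `𝓕` (`exists_coinv_lift`). When `D/G` is affine, all 1-cocycles are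
coboundaries by faithfully flat descent: after base change along `D → D/G` the torsor is trivialized
by the difference map `D ×_{D/G} D → G`, which provides an explicit cobounding element
(`lTensor_defect_extendLeft`, `exists_coinvDefect_eq`).
-/

noncomputable section

namespace QuantumMoment

/-! ### Reduction modulo `ħ` -/

section Reduction

variable {k : Type*} [CommRing k]

theorem exists_eps_mul_of_fst_eq_zero {c : DualNumber k} (hc : TrivSqZeroExt.fst c = 0) :
    c = DualNumber.eps * (TrivSqZeroExt.inl (TrivSqZeroExt.snd c)) := by
  ext <;> simp [hc]

/-- A map of modules exhibiting `B` as `M / ħ M`. -/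
structure IsReduction {M B : Type*} [AddCommGroup M] [Module (DualNumber k) M]
    [AddCommGroup B] [Module k B] (red : M →ₛₗ[modHbar k] B) : Prop where
  surjective : Function.Surjective red
  ker : ∀ m, red m = 0 ↔ ∃ m', m = (DualNumber.eps : DualNumber k) • m'

variable {M N B C : Type*} [AddCommGroup M] [Module (DualNumber k) M]
  [AddCommGroup N] [Module (DualNumber k) N] [AddCommGroup B] [Module k B]
  [AddCommGroup C] [Module k C]

theorem eps_smul_eps_smul (m : M) :
    (DualNumber.eps : DualNumber k) • (DualNumber.eps : DualNumber k) • m = 0 := by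
  rw [smul_smul, DualNumber.eps_mul_eps, zero_smul]

theorem red_eps_smul (red : M →ₛₗ[modHbar k] B) (m : M) :
    red ((DualNumber.eps : DualNumber k) • m) = 0 := by
  rw [LinearMap.map_smulₛₗ]
  simp [modHbar]

/-- In a flat module over the dual numbers, the kernel of `ħ` is the image of `ħ`. -/
theorem exists_eq_eps_smul [Module.Flat (DualNumber k) M] {m : M}
    (hm : (DualNumber.eps : DualNumber k) • m = 0) :
    ∃ m', m = (DualNumber.eps : DualNumber k) • m' := by
  have h := Module.Flat.isTrivialRelation_of_sum_smul_eq_zero (ι := Unit)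
    (f := fun _ => (DualNumber.eps : DualNumber k)) (x := fun _ => m) (by simpa using hm)
  obtain ⟨κ, a, y, hy, ha⟩ := h
  have hs : ∀ j, a () j = DualNumber.eps * TrivSqZeroExt.inl (TrivSqZeroExt.snd (a () j)) := by
    intro j
    apply exists_eps_mul_of_fst_eq_zero
    have := congrArg TrivSqZeroExt.snd (ha j)
    simpa using this
  refine ⟨∑ j, (TrivSqZeroExt.inl (TrivSqZeroExt.snd (a () j)) : DualNumber k) • y j, ?_⟩
  rw [Finset.smul_sum]
  refine (hy ()).trans (Finset.sum_congr rfl fun j _ => ?_)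
  rw [smul_smul, ← hs j]

namespace IsReduction

variable {red : M →ₛₗ[modHbar k] B} {red' : N →ₛₗ[modHbar k] C}

theorem eps_smul_congr (hr : IsReduction red) {m m' : M} (h : red m = red m') :
    (DualNumber.eps : DualNumber k) • m = (DualNumber.eps : DualNumber k) • m' := by
  obtain ⟨n, hn⟩ := (hr.ker (m - m')).1 (by rw [map_sub, h, sub_self])
  rw [← sub_eq_zero, ← smul_sub, hn, eps_smul_eps_smul]

/-- Multiplication by `ħ`, as a map `M / ħ → M`. -/
def hbar (hr : IsReduction red) : B →ₛₗ[TrivSqZeroExt.inlHom k k] M where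
  toFun b := (DualNumber.eps : DualNumber k) • Function.surjInv hr.surjective b
  map_add' b b' := by
    rw [← smul_add]
    apply hr.eps_smul_congr
    rw [map_add]
    simp only [Function.surjInv_eq hr.surjective]
  map_smul' c b := by
    rw [smul_comm]
    apply hr.eps_smul_congr
    rw [LinearMap.map_smulₛₗ]
    simp [Function.surjInv_eq, modHbar]

theorem hbar_red (hr : IsReduction red) (m : M) :
    hr.hbar (red m) = (DualNumber.eps : DualNumber k) • m :=
  hr.eps_smul_congr (Function.surjInv_eq hr.surjective _)

theorem eps_smul_hbar (hr : IsReduction red) (b : B) :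
    (DualNumber.eps : DualNumber k) • hr.hbar b = 0 :=
  eps_smul_eps_smul _

theorem hbar_smul (hr : IsReduction red) (c : k) (b : B) :
    hr.hbar (c • b) = (TrivSqZeroExt.inl c : DualNumber k) • hr.hbar b :=
  hr.hbar.map_smulₛₗ c b

theorem hbar_injective [Module.Flat (DualNumber k) M] (hr : IsReduction red) :
    Function.Injective hr.hbar := by
  rw [injective_iff_map_eq_zero]
  intro b hb
  obtain ⟨m, rfl⟩ := hr.surjective b
  rw [hbar_red] at hb
  exact (hr.ker m).2 (exists_eq_eps_smul hb)

theorem eps_smul_eq_zero_iff [Module.Flat (DualNumber k) M] (hr : IsReduction red) {m : M} :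
    (DualNumber.eps : DualNumber k) • m = 0 ↔ red m = 0 := by
  rw [← hr.hbar_red, map_eq_zero_iff _ hr.hbar_injective]

theorem exists_hbar_eq (hr : IsReduction red) {m : M} (hm : red m = 0) : ∃ b, hr.hbar b = m := by
  obtain ⟨m', rfl⟩ := (hr.ker m).1 hm
  exact ⟨red m', hr.hbar_red m'⟩

variable [Module.Flat (DualNumber k) M] [Module.Flat (DualNumber k) N]

/-- Reduction modulo `ħ` of flat modules commutes with tensor products. -/
theorem tensor (hr : IsReduction red) (hr' : IsReduction red') :
    IsReduction (TensorProduct.map red red') where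
  surjective t := by
    induction t with
    | zero => exact ⟨0, map_zero _⟩
    | add s t hs ht =>
      obtain ⟨s, rfl⟩ := hs
      obtain ⟨t, rfl⟩ := ht
      exact ⟨s + t, map_add _ _ _⟩
    | tmul b c =>
      obtain ⟨b, rfl⟩ := hr.surjective b
      obtain ⟨c, rfl⟩ := hr'.surjective c
      exact ⟨b ⊗ₜ c, TensorProduct.map_tmul _ _ _ _⟩
  ker t := by
    refine ⟨fun ht => ?_, ?_⟩
    · let s : C → N := Function.surjInv hr'.surjective
      have hs : ∀ c, red' (s c) = c := Function.surjInv_eq hr'.surjective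
      have key : ∀ b n n', red' n = red' n' →
          hr.hbar b ⊗ₜ[DualNumber k] n = hr.hbar b ⊗ₜ[DualNumber k] n' := by
        intro b n n' h
        obtain ⟨m, rfl⟩ := hr.surjective b
        rw [hbar_red, TensorProduct.smul_tmul, TensorProduct.smul_tmul, hr'.eps_smul_congr h]
      -- `b ⊗ c ↦ ħ (b ⊗ c)` is well defined on the tensor product of the reductions
      let L : B →ₛₗ[TrivSqZeroExt.inlHom k k] C →ₛₗ[TrivSqZeroExt.inlHom k k]
          M ⊗[DualNumber k] N :=
        LinearMap.mk₂'ₛₗ _ _ (fun b c => hr.hbar b ⊗ₜ[DualNumber k] s c)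
          (fun b b' c => by rw [map_add, TensorProduct.add_tmul])
          (fun r b c => by rw [LinearMap.map_smulₛₗ, TensorProduct.smul_tmul'])
          (fun b c c' => by
            rw [← TensorProduct.tmul_add]
            exact key _ _ _ (by rw [map_add, hs, hs, hs]))
          (fun r b c => by
            rw [← TensorProduct.tmul_smul]
            refine key _ _ _ ?_
            rw [LinearMap.map_smulₛₗ, hs, hs]
            simp [modHbar])
      have hL : ∀ t, TensorProduct.lift L (TensorProduct.map red red' t) =
          (DualNumber.eps : DualNumber k) • t := by
        intro t
        induction t with
        | zero => rw [map_zero, map_zero, smul_zero]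
        | add s t hs ht => rw [map_add, map_add, hs, ht, smul_add]
        | tmul m n =>
          rw [TensorProduct.map_tmul, TensorProduct.lift.tmul, TensorProduct.smul_tmul',
            ← hr.hbar_red]
          exact key _ _ _ (hs _)
      apply exists_eq_eps_smul
      rw [← hL, ht, map_zero]
    · rintro ⟨t', rfl⟩
      exact red_eps_smul _ t'

theorem hbar_tmul_red (hr : IsReduction red) (hr' : IsReduction red') (b : B) (n : N) :
    (hr.tensor hr').hbar (b ⊗ₜ red' n) = hr.hbar b ⊗ₜ n := by
  obtain ⟨m, rfl⟩ := hr.surjective b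
  rw [← TensorProduct.map_tmul, hbar_red, hbar_red, TensorProduct.smul_tmul']

theorem hbar_red_tmul (hr : IsReduction red) (hr' : IsReduction red') (m : M) (c : C) :
    (hr.tensor hr').hbar (red m ⊗ₜ c) = m ⊗ₜ hr'.hbar c := by
  obtain ⟨n, rfl⟩ := hr'.surjective c
  rw [← TensorProduct.map_tmul, hbar_red, hbar_red, TensorProduct.tmul_smul]

end IsReduction

/-- The reduction of the dual numbers themselves. -/
theorem isReduction_modHbar :
    IsReduction (k := k) (M := DualNumber k) (B := k)
      { toFun := modHbar k, map_add' := map_add _, map_smul' := fun c m => map_mul _ c m } where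
  surjective b := ⟨TrivSqZeroExt.inl b, rfl⟩
  ker m := by
    refine ⟨fun h => ⟨_, exists_eps_mul_of_fst_eq_zero h⟩, ?_⟩
    rintro ⟨m', rfl⟩
    exact red_eps_smul _ m'

/-- A bilinear map vanishing modulo `ħ` is `ħ` times a bilinear map of the reductions. -/
theorem exists_bilin_of_red_eq_zero {M' B' : Type*} [AddCommGroup M'] [Module (DualNumber k) M']
    [AddCommGroup B'] [Module k B'] [Module.Flat (DualNumber k) N]
    {red : M →ₛₗ[modHbar k] B} {red' : M' →ₛₗ[modHbar k] B'} {redN : N →ₛₗ[modHbar k] C}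
    (hr : IsReduction red) (hr' : IsReduction red') (hN : IsReduction redN)
    (φ : M →ₗ[DualNumber k] M' →ₗ[DualNumber k] N) (hφ : ∀ m m', redN (φ m m') = 0) :
    ∃ ψ : B →ₗ[k] B' →ₗ[k] C, ∀ m m', φ m m' = hN.hbar (ψ (red m) (red' m')) := by
  -- `g` is well defined on `M × M'`, and by `ħ² = 0` it only depends on the reductions
  choose g hg using fun m m' => hN.exists_hbar_eq (hφ m m')
  have key : ∀ m₁ m₂ m₁' m₂', red m₁ = red m₂ → red' m₁' = red' m₂' → g m₁ m₁' = g m₂ m₂' := by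
    intro m₁ m₂ m₁' m₂' h h'
    apply hN.hbar_injective
    rw [hg, hg]
    obtain ⟨n, hn⟩ := (hr.ker (m₁ - m₂)).1 (by rw [map_sub, h, sub_self])
    obtain ⟨n', hn'⟩ := (hr'.ker (m₁' - m₂')).1 (by rw [map_sub, h', sub_self])
    rw [sub_eq_iff_eq_add] at hn hn'
    rw [hn, hn']
    simp only [map_add, map_smul, LinearMap.add_apply, LinearMap.smul_apply, ← hg,
      hN.eps_smul_hbar, zero_add]
  let s : B → M := Function.surjInv hr.surjective
  let s' : B' → M' := Function.surjInv hr'.surjective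
  have hs : ∀ b, red (s b) = b := Function.surjInv_eq hr.surjective
  have hs' : ∀ b, red' (s' b) = b := Function.surjInv_eq hr'.surjective
  have hgadd : ∀ m₁ m₂ m', g (m₁ + m₂) m' = g m₁ m' + g m₂ m' := fun m₁ m₂ m' =>
    hN.hbar_injective (by simp only [map_add, hg, LinearMap.add_apply])
  have hgadd' : ∀ m m₁ m₂, g m (m₁ + m₂) = g m m₁ + g m m₂ := fun m₁ m₂ m' =>
    hN.hbar_injective (by simp only [map_add, hg])
  have hgs : ∀ (c : k) m m', g ((TrivSqZeroExt.inl c : DualNumber k) • m) m' = c • g m m' :=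
    fun c m m' => hN.hbar_injective (by
      rw [hN.hbar_smul, hg, hg, map_smul, LinearMap.smul_apply])
  have hgs' : ∀ (c : k) m m', g m ((TrivSqZeroExt.inl c : DualNumber k) • m') = c • g m m' :=
    fun c m m' => hN.hbar_injective (by rw [hN.hbar_smul, hg, hg, map_smul])
  refine ⟨LinearMap.mk₂ k (fun b b' => g (s b) (s' b')) (fun b₁ b₂ b' => ?_) (fun c b b' => ?_)
    (fun b b₁ b₂ => ?_) (fun c b b' => ?_), fun m m' => ?_⟩
  · rw [← hgadd]
    exact key _ _ _ _ (by rw [map_add, hs, hs, hs]) rfl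
  · rw [← hgs]
    exact key _ _ _ _ (by rw [LinearMap.map_smulₛₗ, hs, hs]; simp [modHbar]) rfl
  · rw [← hgadd']
    exact key _ _ _ _ rfl (by rw [map_add, hs', hs', hs'])
  · rw [← hgs']
    exact key _ _ _ _ rfl (by rw [LinearMap.map_smulₛₗ, hs', hs']; simp [modHbar])
  · rw [LinearMap.mk₂_apply, ← hg m m', key _ _ _ _ (hs (red m)) (hs' (red' m'))]

theorem AlgReduction.isReduction {A O : Type*} [Ring A] [Algebra (DualNumber k) A] [Ring O]
    [Algebra k O] (red : AlgReduction k A O) : IsReduction red.map :=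
  ⟨red.surjective, red.ker⟩

end Reduction

/-! ### The Lagrangian complement defined by a classical `r`-matrix -/

section Complement

variable {k O : Type*} [CommRing k] [CommRing O] [Bialgebra k O]

/-- A linear form on the cotangent space, as a tangent vector. -/
theorem exists_lieAlg_of_cotangent (φ : Module.Dual k (CotangentAtOne k O)) :
    ∃ x : lieAlg k O, ∀ a : RingHom.ker (Bialgebra.counitAlgHom k O),
      x.1 a = φ (Ideal.toCotangent _ a) := by
  let I := RingHom.ker (Bialgebra.counitAlgHom k O)
  -- the projection `a ↦ a - ε(a)` onto the augmentation ideal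
  let T : O →ₗ[k] I := LinearMap.codRestrict (I.restrictScalars k)
    (LinearMap.id - Algebra.linearMap k O ∘ₗ Coalgebra.counit) (fun a => by
      change Bialgebra.counitAlgHom k O _ = 0
      simp)
  have hT : ∀ a, (T a : O) = a - algebraMap k O (Coalgebra.counit a) := fun a => rfl
  have hTI : ∀ a : I, T a = a := fun a => by
    have ha : Coalgebra.counit (R := k) (a : O) = 0 := a.2
    ext
    rw [hT, ha, map_zero, sub_zero]
  have hmul : ∀ a b : O, I.toCotangent (T (a * b)) =
      (Coalgebra.counit (R := k) a) • I.toCotangent (T b) +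
        (Coalgebra.counit (R := k) b) • I.toCotangent (T a) := by
    intro a b
    -- the two sides differ by `T a * T b`, which lies in the square of the augmentation ideal
    have e : T (a * b) = Coalgebra.counit (R := k) a • T b + Coalgebra.counit (R := k) b • T a +
        (T a : O) • T b := by
      ext
      change _ = Coalgebra.counit (R := k) a • (T b : O) + Coalgebra.counit (R := k) b • (T a : O) +
        (T a : O) * (T b : O)
      simp only [hT, Algebra.smul_def, Bialgebra.counit_mul, map_mul]
      ring
    have e2 : I.toCotangent ((T a : O) • T b) = 0 := by
      rw [Ideal.toCotangent_eq_zero, pow_two]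
      exact Ideal.mul_mem_mul (T a).2 (T b).2
    have hs : ∀ (c : k) (t : I), I.toCotangent (c • t) = c • I.toCotangent t := fun c t => by
      rw [← algebraMap_smul O c t, map_smul, algebraMap_smul]
    rw [e, map_add, map_add, e2, add_zero, hs, hs]
  refine ⟨⟨φ ∘ₗ (I.toCotangent.restrictScalars k) ∘ₗ T, fun a b => ?_⟩, fun a => ?_⟩
  · change φ (I.toCotangent (T (a * b))) = _ * φ (I.toCotangent (T b)) +
      φ (I.toCotangent (T a)) * _
    rw [hmul, map_add, map_smul, map_smul, smul_eq_mul, smul_eq_mul]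
    ring
  · change φ (I.toCotangent (T a)) = _
    rw [hTI]

theorem lieAlg_apply_one (x : lieAlg k O) : x.1 1 = 0 := by
  simpa using x.2 1 1

theorem lieAlg_ext_ker {x y : lieAlg k O}
    (h : ∀ a : RingHom.ker (Bialgebra.counitAlgHom k O), x.1 a = y.1 a) : x = y := by
  ext a
  have := h ⟨a - algebraMap k O (Coalgebra.counit a), by simp [RingHom.mem_ker]⟩
  simpa [Algebra.algebraMap_eq_smul_one, lieAlg_apply_one] using this

/-- A tangent vector, as a linear form on the cotangent space. -/
theorem exists_cotangent_of_lieAlg (x : lieAlg k O) :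
    ∃ φ : Module.Dual k (CotangentAtOne k O), ∀ a : RingHom.ker (Bialgebra.counitAlgHom k O),
      φ (Ideal.toCotangent _ a) = x.1 a := by
  refine ⟨Ideal.Cotangent.lift
    (x.1 ∘ₗ (Submodule.subtype (RingHom.ker (Bialgebra.counitAlgHom k O))).restrictScalars k)
    fun a b => ?_, fun a => Ideal.Cotangent.lift_toCotangent _ _ a⟩
  have ha : Coalgebra.counit (R := k) (a : O) = 0 := a.2
  have hb : Coalgebra.counit (R := k) (b : O) = 0 := b.2
  change x.1 ((a : O) * b) = 0
  rw [x.2, ha, hb, zero_mul, mul_zero, add_zero]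

/-- When the cotangent space is finite free, hence reflexive, every linear form on the Lie algebra
is the differential of a function. -/
theorem differentialAtOne_surjective [Module.Free k (CotangentAtOne k O)]
    [Module.Finite k (CotangentAtOne k O)] :
    Function.Surjective (differentialAtOne (k := k) (O := O)) := by
  intro ξ
  choose T hT using exists_lieAlg_of_cotangent (k := k) (O := O)
  let T' : Module.Dual k (CotangentAtOne k O) →ₗ[k] lieAlg k O :=
    { toFun := T
      map_add' := fun φ ψ => lieAlg_ext_ker fun a => by
        change (T (φ + ψ)).1 a = (T φ).1 a + (T ψ).1 a
        rw [hT, hT, hT, LinearMap.add_apply]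
      map_smul' := fun c φ => lieAlg_ext_ker fun a => by
        change (T (c • φ)).1 a = c • (T φ).1 a
        rw [hT, hT, LinearMap.smul_apply] }
  obtain ⟨m, hm⟩ := (Module.evalEquiv k (CotangentAtOne k O)).surjective (ξ ∘ₗ T')
  obtain ⟨a, rfl⟩ := Ideal.toCotangent_surjective _ m
  refine ⟨a, LinearMap.ext fun x => ?_⟩
  obtain ⟨φ, hφ⟩ := exists_cotangent_of_lieAlg x
  have hxT : T' φ = x := lieAlg_ext_ker fun a => (hT φ a).trans (hφ a)
  have := congrArg (fun F => F φ) hm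
  simp only [Module.evalEquiv_apply, Module.Dual.eval_apply, LinearMap.comp_apply, hxT] at this
  rw [← this, hφ]
  rfl

variable {OD OG : Type*} [CommRing OD] [HopfAlgebra k OD]
  [CommRing OG] [HopfAlgebra k OG]

/-- If `r ∈ 𝔡 ⊗ 𝔤` has symmetric part `c`, then `r₂(𝔤*)` is a Lagrangian complement `𝔥` to `𝔤`, and
`r` is the canonical `r`-matrix of `𝔥`: for `a ∈ 𝒪(D)` with differential `da`, the decomposition
`c(da) = r(a, -) + r(-, a)` is the decomposition along `𝔡 = 𝔤 ⊕ 𝔥`. -/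
theorem exists_lagrangianComplement (P : GroupPair k OD OG)
    (hsurj : Function.Surjective (differentialAtOne (k := k) (O := OD)))
    (r : OD →ₗ[k] OG →ₗ[k] k)
    (hleft : ∀ a a' b, r (a * a') b =
      Coalgebra.counit (R := k) a * r a' b + r a b * Coalgebra.counit (R := k) a')
    (hright : ∀ a b b', r a (b * b') =
      Coalgebra.counit (R := k) b * r a b' + r a b * Coalgebra.counit (R := k) b')
    (hsymm : ∀ a a', r a (P.res a') + r a' (P.res a) = bilinOf P.c a a') :
    ∃ h : LagrangianComplement P,
      (∀ x, x ∈ h.carrier ↔ ∃ b, ∀ a, x.1 a = r a b) ∧ h.rMatrix = r := by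
  let L : OD →ₗ[k] lieAlg k OG := LinearMap.codRestrict _ r (fun a b b' => hright a b b')
  let R : OG →ₗ[k] lieAlg k OD := LinearMap.codRestrict _ r.flip (fun b a a' => hleft a a' b)
  have hdec : ∀ a, sharp P.c (differentialAtOne a) = lieMap P.res (L a) + R (P.res a) := by
    intro a
    ext a'
    exact (hsymm a a').symm
  have hRzero : ∀ a, differentialAtOne (k := k) a ∈
      (LinearMap.range (lieMap P.res)).dualAnnihilator → R (P.res a) = 0 := by
    intro a ha
    rw [Submodule.mem_dualAnnihilator] at ha
    ext a'
    exact ha _ ⟨L a', rfl⟩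
  -- `L` and `R` are transposes of each other
  have hLzero : ∀ a, (∀ b, differentialAtOne a (R b) = 0) → L a = 0 := fun a ha => by
    ext b
    exact ha b
  -- as `𝔤` is Lagrangian, `c(da) ∈ 𝔤` forces `da` to annihilate `𝔤`
  have hmem : ∀ a, sharp P.c (differentialAtOne a) ∈ LinearMap.range (lieMap P.res) →
      R (P.res a) = 0 := by
    intro a ha
    apply hRzero
    rw [← P.lagrangian] at ha
    obtain ⟨ξ, hξ, e⟩ := ha
    rwa [← P.nondegenerate.1 e]
  have hdisj : ∀ g b, lieMap P.res g = R b → R b = 0 := by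
    intro g b hgb
    obtain ⟨a, rfl⟩ := P.res_surjective b
    apply hmem
    rw [hdec, ← hgb, ← map_add]
    exact ⟨_, rfl⟩
  have hcompl : IsCompl (LinearMap.range (lieMap P.res)) (LinearMap.range R) := by
    constructor
    · rw [Submodule.disjoint_def]
      rintro x ⟨g, rfl⟩ ⟨b, hb⟩
      rw [← hb]
      exact hdisj g b hb.symm
    · rw [codisjoint_iff, eq_top_iff]
      intro x _
      obtain ⟨ξ, rfl⟩ := P.nondegenerate.2 x
      obtain ⟨a, rfl⟩ := hsurj ξ
      rw [hdec]
      exact Submodule.add_mem_sup ⟨_, rfl⟩ ⟨_, rfl⟩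
  have hlag : IsLagrangian P.c (LinearMap.range R) := by
    apply le_antisymm
    · rintro _ ⟨ξ, hξ, rfl⟩
      obtain ⟨a, rfl⟩ := hsurj ξ
      have ha := (Submodule.mem_dualAnnihilator _).1 hξ
      rw [hdec, hLzero a (fun b => ha _ ⟨b, rfl⟩), map_zero, zero_add]
      exact ⟨_, rfl⟩
    · rintro _ ⟨b, rfl⟩
      obtain ⟨ξ, hξ⟩ := P.nondegenerate.2 (R b)
      obtain ⟨a, rfl⟩ := hsurj ξ
      have e : lieMap P.res (L a) = R (b - P.res a) := by
        rw [map_sub]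
        exact eq_sub_of_add_eq (by rw [← hdec, hξ])
      have hLa : L a = 0 := by
        apply lieMap_injective P.res P.res_surjective
        rw [e, hdisj _ _ e, map_zero]
      refine ⟨_, ?_, hξ⟩
      refine (Submodule.mem_dualAnnihilator _).2 ?_
      rintro _ ⟨b', rfl⟩
      exact congrArg (fun z : lieAlg k OG => z.1 b') hLa
  refine ⟨⟨LinearMap.range R, hlag, hcompl⟩, fun x => ?_, ?_⟩
  · constructor
    · rintro ⟨b, rfl⟩
      exact ⟨b, fun a => rfl⟩
    · rintro ⟨b, hb⟩
      exact ⟨b, by ext a; exact (hb a).symm⟩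
  · ext a b
    have hproj : LagrangianComplement.proj ⟨LinearMap.range R, hlag, hcompl⟩
        (differentialAtOne a) = L a := by
      have e1 : Submodule.projectionOnto _ _ hcompl (lieMap P.res (L a)) =
          LinearEquiv.ofInjective (lieMap P.res)
            (lieMap_injective P.res P.res_surjective) (L a) :=
        Submodule.projectionOnto_apply_of_mem_left hcompl (LinearMap.mem_range_self _ _)
      have e2 : Submodule.projectionOnto _ _ hcompl (R (P.res a)) = 0 :=
        Submodule.projectionOnto_apply_of_mem_right hcompl (LinearMap.mem_range_self _ _)
      simp only [LagrangianComplement.proj, LinearMap.comp_apply, hdec, map_add, e1, e2, add_zero]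
      exact LinearEquiv.symm_apply_apply _ _
    exact congrArg (fun z : lieAlg k OG => z.1 b) hproj

end Complement

/-! ### Pairings to first order in `ħ` -/

section Pairing

variable {k : Type*} [CommRing k]

theorem hbar_modHbar (c : k) :
    (isReduction_modHbar (k := k)).hbar c = TrivSqZeroExt.inr c := by
  refine (isReduction_modHbar.hbar_red (TrivSqZeroExt.inl c : DualNumber k)).trans ?_
  ext <;> simp

theorem inr_smul {M B : Type*} [AddCommGroup M] [Module (DualNumber k) M]
    [AddCommGroup B] [Module k B] {red : M →ₛₗ[modHbar k] B} (hr : IsReduction red)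
    (c : k) (m : M) :
    (TrivSqZeroExt.inr c : DualNumber k) • m = hr.hbar (c • red m) := by
  have : (TrivSqZeroExt.inr c : DualNumber k) = TrivSqZeroExt.inl c * DualNumber.eps := by
    ext <;> simp
  rw [this, mul_smul, ← hr.hbar_red, hr.hbar_smul]

theorem fst_smul_red {M B : Type*} [AddCommGroup M] [Module (DualNumber k) M]
    [AddCommGroup B] [Module k B] (red : M →ₛₗ[modHbar k] B) (c : DualNumber k) (m : M) :
    red (c • m) = TrivSqZeroExt.fst c • red m :=
  red.map_smulₛₗ c m

/-- The convolution product of two functionals which are multiples of the counit modulo `ħ`. -/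
theorem mul'_map_of_counit_add_inr {H O : Type*} [AddCommGroup H] [Module (DualNumber k) H]
    [AddCommGroup O] [Module k O] (red : H →ₛₗ[modHbar k] O)
    (e f g : H →ₗ[DualNumber k] DualNumber k) (α β : DualNumber k) (f₁ g₁ : O →ₗ[k] k)
    (hf : ∀ c, f c = α * e c + TrivSqZeroExt.inr (f₁ (red c)))
    (hg : ∀ c, g c = β * e c + TrivSqZeroExt.inr (g₁ (red c)))
    (t : H ⊗[DualNumber k] H) :
    LinearMap.mul' _ _ (TensorProduct.map f g t) =
      α * β * e (TensorProduct.lid _ _ (e.rTensor H t)) +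
        TrivSqZeroExt.inr
          (TrivSqZeroExt.fst α * g₁ (red (TensorProduct.lid _ _ (e.rTensor H t))) +
          f₁ (red (TensorProduct.rid _ _ (e.lTensor H t))) * TrivSqZeroExt.fst β) := by
  induction t with
  | zero => simp only [map_zero, mul_zero, zero_mul, add_zero, TrivSqZeroExt.inr_zero]
  | add s t hs ht =>
    simp only [map_add, hs, ht, mul_add, add_mul, TrivSqZeroExt.inr_add]
    abel
  | tmul c d =>
    simp only [TensorProduct.map_tmul, LinearMap.mul'_apply, hf, hg, LinearMap.rTensor_tmul,
      TensorProduct.lid_tmul, LinearMap.lTensor_tmul, TensorProduct.rid_tmul, map_smul,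
      fst_smul_red, smul_eq_mul]
    ext
    · simp
      ring
    · simp
      ring

variable {U U' V V' W : Type*} {Ub Ub' Vb Vb' Wb : Type*}
  [AddCommGroup U] [Module (DualNumber k) U] [AddCommGroup U'] [Module (DualNumber k) U']
  [AddCommGroup V] [Module (DualNumber k) V] [AddCommGroup V'] [Module (DualNumber k) V']
  [AddCommGroup W] [Module (DualNumber k) W]
  [AddCommGroup Ub] [Module k Ub] [AddCommGroup Ub'] [Module k Ub']
  [AddCommGroup Vb] [Module k Vb] [AddCommGroup Vb'] [Module k Vb']
  [AddCommGroup Wb] [Module k Wb]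

/-- First-order expansion of `r(u₁, v₁) m(u₂, v₂)` when `r = e ⊗ e' + ħ r₁`. -/
theorem pairFirst_expand {redW : W →ₛₗ[modHbar k] Wb} (hW : IsReduction redW)
    (redU : U →ₛₗ[modHbar k] Ub) (redU' : U' →ₛₗ[modHbar k] Ub')
    (redV : V →ₛₗ[modHbar k] Vb) (redV' : V' →ₛₗ[modHbar k] Vb')
    (r : U →ₗ[DualNumber k] V →ₗ[DualNumber k] DualNumber k) (r₁ : Ub →ₗ[k] Vb →ₗ[k] k)
    (e : U →ₗ[DualNumber k] DualNumber k) (e' : V →ₗ[DualNumber k] DualNumber k)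
    (hr : ∀ u v, r u v = e u * e' v + TrivSqZeroExt.inr (r₁ (redU u) (redV v)))
    (m : U' →ₗ[DualNumber k] V' →ₗ[DualNumber k] W) (m₁ : Ub' →ₗ[k] Vb' →ₗ[k] Wb)
    (hm : ∀ u v, redW (m u v) = m₁ (redU' u) (redV' v))
    (s : U ⊗[DualNumber k] U') (t : V ⊗[DualNumber k] V') :
    pairFirst r m s t =
      m (TensorProduct.lid _ _ (e.rTensor U' s)) (TensorProduct.lid _ _ (e'.rTensor V' t)) +
        hW.hbar (pairFirst r₁ m₁ (TensorProduct.map redU redU' s)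
          (TensorProduct.map redV redV' t)) := by
  unfold pairFirst
  induction s with
  | zero => simp only [map_zero, LinearMap.zero_apply, add_zero]
  | add s s' hs hs' =>
    simp only [map_add, LinearMap.add_apply, hs, hs']
    abel
  | tmul u u' =>
    induction t with
    | zero => simp only [map_zero, add_zero]
    | add t t' ht ht' =>
      simp only [map_add, ht, ht']
      abel
    | tmul v v' =>
      simp only [TensorProduct.map₂_apply_tmul, TensorProduct.lid_tmul, TensorProduct.map_tmul,
        LinearMap.rTensor_tmul, hr, add_smul, inr_smul hW, hm, map_smul, LinearMap.smul_apply,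
        mul_smul, smul_comm (e u)]

/-- First-order expansion of `r(u₂, v₂) m(u₁, v₁)` when `r = e ⊗ e' + ħ r₁`. -/
theorem pairSecond_expand {redW : W →ₛₗ[modHbar k] Wb} (hW : IsReduction redW)
    (redU : U →ₛₗ[modHbar k] Ub) (redU' : U' →ₛₗ[modHbar k] Ub')
    (redV : V →ₛₗ[modHbar k] Vb) (redV' : V' →ₛₗ[modHbar k] Vb')
    (r : U' →ₗ[DualNumber k] V' →ₗ[DualNumber k] DualNumber k) (r₁ : Ub' →ₗ[k] Vb' →ₗ[k] k)
    (e : U' →ₗ[DualNumber k] DualNumber k) (e' : V' →ₗ[DualNumber k] DualNumber k)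
    (hr : ∀ u v, r u v = e u * e' v + TrivSqZeroExt.inr (r₁ (redU' u) (redV' v)))
    (m : U →ₗ[DualNumber k] V →ₗ[DualNumber k] W) (m₁ : Ub →ₗ[k] Vb →ₗ[k] Wb)
    (hm : ∀ u v, redW (m u v) = m₁ (redU u) (redV v))
    (s : U ⊗[DualNumber k] U') (t : V ⊗[DualNumber k] V') :
    pairSecond m r s t =
      m (TensorProduct.rid _ _ (e.lTensor U s)) (TensorProduct.rid _ _ (e'.lTensor V t)) +
        hW.hbar (pairSecond m₁ r₁ (TensorProduct.map redU redU' s)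
          (TensorProduct.map redV redV' t)) := by
  unfold pairSecond
  induction s with
  | zero => simp only [map_zero, LinearMap.zero_apply, add_zero]
  | add s s' hs hs' =>
    simp only [map_add, LinearMap.add_apply, hs, hs']
    abel
  | tmul u u' =>
    induction t with
    | zero => simp only [map_zero, add_zero]
    | add t t' ht ht' =>
      simp only [map_add, ht, ht']
      abel
    | tmul v v' =>
      simp only [TensorProduct.map₂_apply_tmul, TensorProduct.rid_tmul, TensorProduct.map_tmul,
        LinearMap.lTensor_tmul, hr, add_smul, inr_smul hW, hm, map_smul, LinearMap.smul_apply,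
        mul_smul, smul_comm (e u')]

theorem map_pairSecond {R U U' V V' W Z : Type*} [CommRing R] [AddCommGroup U] [Module R U]
    [AddCommGroup U'] [Module R U'] [AddCommGroup V] [Module R V] [AddCommGroup V'] [Module R V']
    [AddCommGroup W] [Module R W] [AddCommGroup Z] [Module R Z] (g : W →ₗ[R] Z)
    (m : U →ₗ[R] V →ₗ[R] W) (r : U' →ₗ[R] V' →ₗ[R] R) (s : U ⊗[R] U') (t : V ⊗[R] V') :
    g (pairSecond m r s t) = pairSecond (m.compr₂ g) r s t := by
  unfold pairSecond
  induction s with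
  | zero => simp only [map_zero, LinearMap.zero_apply]
  | add s s' hs hs' => simp only [map_add, LinearMap.add_apply, hs, hs']
  | tmul u u' =>
    induction t with
    | zero => simp only [map_zero]
    | add t t' ht ht' => simp only [map_add, ht, ht']
    | tmul v v' => simp

end Pairing

/-! ### Brackets as first-order commutators -/

section Commutator

variable {k A O : Type*} [CommRing k] [Ring A] [Algebra (DualNumber k) A] [CommRing O]
  [Algebra k O]

/-- Multiplication by `ħ` is a map of bimodules over the deformed algebra. -/
theorem hbar_mul_red (red : AlgReduction k A O) (x : O) (a : A) :
    red.isReduction.hbar (x * red.map a) = red.isReduction.hbar x * a := by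
  obtain ⟨y, rfl⟩ := red.surjective x
  rw [← red.map_mul, IsReduction.hbar_red, IsReduction.hbar_red, smul_mul_assoc]

theorem hbar_red_mul (red : AlgReduction k A O) (x : O) (a : A) :
    red.isReduction.hbar (red.map a * x) = a * red.isReduction.hbar x := by
  obtain ⟨y, rfl⟩ := red.surjective x
  rw [← red.map_mul, IsReduction.hbar_red, IsReduction.hbar_red, mul_smul_comm]

/-- A flat first-order deformation of a commutative algebra defines a bivector. -/
theorem exists_bivector_of_commutator [Module.Flat (DualNumber k) A] (red : AlgReduction k A O) :
    ∃ π : Bivector k O, ∀ a b, a * b - b * a =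
      red.isReduction.hbar (π.bracket (red.map a) (red.map b)) := by
  obtain ⟨ψ, hψ⟩ := exists_bilin_of_red_eq_zero red.isReduction red.isReduction red.isReduction
    (LinearMap.mul (DualNumber k) A - (LinearMap.mul (DualNumber k) A).flip) (fun a b => by
      simp only [LinearMap.sub_apply, LinearMap.flip_apply, LinearMap.mul_apply', map_sub,
        red.map_mul]
      ring)
  have hψ' : ∀ a b, a * b - b * a = red.isReduction.hbar (ψ (red.map a) (red.map b)) := hψ
  refine ⟨⟨ψ, fun f => ?_, fun f g g' => ?_⟩, hψ'⟩
  · obtain ⟨a, rfl⟩ := red.surjective f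
    apply red.isReduction.hbar_injective
    rw [← hψ', sub_self, map_zero]
  · obtain ⟨a, rfl⟩ := red.surjective f
    obtain ⟨b, rfl⟩ := red.surjective g
    obtain ⟨b', rfl⟩ := red.surjective g'
    apply red.isReduction.hbar_injective
    rw [map_add, hbar_mul_red, hbar_red_mul, ← red.map_mul, ← hψ', ← hψ', ← hψ']
    noncomm_ring

/-- The commutator in a tensor product, to first order. -/
theorem commutator_tensor {A' O' : Type*} [Ring A'] [Algebra (DualNumber k) A'] [CommRing O']
    [Algebra k O'] [Module.Flat (DualNumber k) A] [Module.Flat (DualNumber k) A']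
    (red : AlgReduction k A O) (red' : AlgReduction k A' O')
    (π : O →ₗ[k] O →ₗ[k] O) (π' : O' →ₗ[k] O' →ₗ[k] O')
    (hπ : ∀ a b, a * b - b * a = red.isReduction.hbar (π (red.map a) (red.map b)))
    (hπ' : ∀ a b, a * b - b * a = red'.isReduction.hbar (π' (red'.map a) (red'.map b)))
    (s t : A ⊗[DualNumber k] A') :
    s * t - t * s = (red.isReduction.tensor red'.isReduction).hbar
      (TensorProduct.map₂ π (LinearMap.mul k O') (TensorProduct.map red.map red'.map s)
          (TensorProduct.map red.map red'.map t) +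
        TensorProduct.map₂ (LinearMap.mul k O) π' (TensorProduct.map red.map red'.map s)
          (TensorProduct.map red.map red'.map t)) := by
  induction s with
  | zero => simp only [map_zero, LinearMap.zero_apply, add_zero, zero_mul, mul_zero, sub_zero]
  | add s s' hs hs' =>
    have : (s + s') * t - t * (s + s') = (s * t - t * s) + (s' * t - t * s') := by noncomm_ring
    rw [this, hs, hs']
    simp only [map_add, LinearMap.add_apply]
    abel
  | tmul a a' =>
    induction t with
    | zero => simp only [map_zero, add_zero, zero_mul, mul_zero, sub_zero]
    | add t t' ht ht' =>
      have : a ⊗ₜ[DualNumber k] a' * (t + t') - (t + t') * a ⊗ₜ[DualNumber k] a' =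
        (a ⊗ₜ[DualNumber k] a' * t - t * a ⊗ₜ[DualNumber k] a') +
        (a ⊗ₜ[DualNumber k] a' * t' - t' * a ⊗ₜ[DualNumber k] a') := by noncomm_ring
      rw [this, ht, ht']
      simp only [map_add]
      abel
    | tmul b b' =>
      simp only [TensorProduct.map_tmul, TensorProduct.map₂_apply_tmul, LinearMap.mul_apply',
        Algebra.TensorProduct.tmul_mul_tmul, map_add]
      rw [← red'.map_mul, red.isReduction.hbar_tmul_red red'.isReduction, ← hπ, mul_comm (red.map a), ← red.map_mul,
        red.isReduction.hbar_red_tmul red'.isReduction, ← hπ', TensorProduct.sub_tmul, TensorProduct.tmul_sub]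
      abel

end Commutator

/-! ### Coinvariants modulo `ħ` -/

section Coinvariants

/-- The coboundary, up to sign, of 1-cochains in the cobar complex computing the derived coinvariants of `H` as
a left `K`-comodule: `κ ⊗ h ↦ κ₍₁₎ ⊗ κ₍₂₎ ⊗ h - κ ⊗ f(h₍₁₎) ⊗ h₍₂₎ - 1 ⊗ κ ⊗ h`. -/
def cobar {R H K : Type*} [CommRing R] [Ring H] [Bialgebra R H] [Ring K] [Bialgebra R K]
    (f : H →ₐc[R] K) : K ⊗[R] H →ₗ[R] K ⊗[R] (K ⊗[R] H) :=
  (TensorProduct.assoc R K K H).toLinearMap ∘ₗ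
      (Coalgebra.comul (R := R) (A := K)).rTensor H -
    (TensorProduct.map (f : H →ₐ[R] K).toLinearMap LinearMap.id ∘ₗ
      Coalgebra.comul (R := R) (A := H)).lTensor K -
    TensorProduct.mk R K (K ⊗[R] H) 1

theorem cobar_coinvDefect {R H K : Type*} [CommRing R] [Ring H] [Bialgebra R H] [Ring K]
    [Bialgebra R K] (f : H →ₐc[R] K) (h : H) : cobar f (coinvDefect f h) = 0 := by
  have e1 : ∀ t : H ⊗[R] H, TensorProduct.assoc R K K H
      ((Coalgebra.comul (R := R) (A := K)).rTensor H
        (TensorProduct.map (f : H →ₐ[R] K).toLinearMap LinearMap.id t)) =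
      TensorProduct.map (f : H →ₐ[R] K).toLinearMap
        (TensorProduct.map (f : H →ₐ[R] K).toLinearMap LinearMap.id)
        (TensorProduct.assoc R H H H ((Coalgebra.comul (R := R) (A := H)).rTensor H t)) := by
    intro t
    induction t with
    | zero => simp only [map_zero]
    | add s t hs ht => simp only [map_add, hs, ht]
    | tmul a b =>
      simp only [TensorProduct.map_tmul, LinearMap.rTensor_tmul, LinearMap.id_apply]
      have : Coalgebra.comul (R := R) ((f : H →ₐ[R] K).toLinearMap a) =
          TensorProduct.map (f : H →ₐ[R] K).toLinearMap (f : H →ₐ[R] K).toLinearMap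
            (Coalgebra.comul (R := R) a) := (CoalgHomClass.map_comp_comul_apply f a).symm
      rw [this]
      generalize Coalgebra.comul (R := R) a = s
      induction s with
      | zero => simp only [map_zero, TensorProduct.zero_tmul]
      | add s t hs ht => simp only [map_add, TensorProduct.add_tmul, hs, ht]
      | tmul c d => simp
  have e2 : ∀ t : H ⊗[R] H, (TensorProduct.map (f : H →ₐ[R] K).toLinearMap LinearMap.id ∘ₗ
      Coalgebra.comul (R := R) (A := H)).lTensor K
        (TensorProduct.map (f : H →ₐ[R] K).toLinearMap LinearMap.id t) =
      TensorProduct.map (f : H →ₐ[R] K).toLinearMap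
        (TensorProduct.map (f : H →ₐ[R] K).toLinearMap LinearMap.id)
        ((Coalgebra.comul (R := R) (A := H)).lTensor H t) := by
    intro t
    induction t with
    | zero => simp only [map_zero]
    | add s t hs ht => simp only [map_add, hs, ht]
    | tmul a b => simp
  simp only [cobar, coinvDefect, LinearMap.sub_apply, LinearMap.comp_apply, map_sub,
    LinearEquiv.coe_coe, e1, e2, Coalgebra.coassoc_apply, TensorProduct.mk_apply,
    LinearMap.rTensor_tmul, LinearMap.lTensor_tmul, Bialgebra.comul_one,
    Algebra.TensorProduct.one_def, TensorProduct.assoc_tmul]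
  abel

variable {k OD OG HD HG : Type*} [CommRing k] [CommRing OD] [HopfAlgebra k OD]
    [CommRing OG] [HopfAlgebra k OG]
    [Ring HD] [HopfAlgebra (DualNumber k) HD] [Ring HG] [HopfAlgebra (DualNumber k) HG]
    {P : GroupPair k OD OG} (Q : Quantization P HD HG)

theorem red_map_res (t : HD ⊗[DualNumber k] HD) :
    TensorProduct.map Q.redG.map Q.redD.map
      (TensorProduct.map (Q.res : HD →ₐ[DualNumber k] HG).toLinearMap LinearMap.id t) =
    TensorProduct.map (P.res : OD →ₐ[k] OG).toLinearMap LinearMap.id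
      (TensorProduct.map Q.redD.map Q.redD.map t) := by
  induction t with
  | zero => simp only [map_zero]
  | add s t hs ht => simp only [map_add, hs, ht]
  | tmul a b =>
    simp only [TensorProduct.map_tmul, LinearMap.id_apply]
    congr 1
    exact Q.red_res a

theorem red_coinvDefect (y : HD) :
    TensorProduct.map Q.redG.map Q.redD.map (coinvDefect Q.res y) =
      coinvDefect P.res (Q.redD.map y) := by
  simp only [coinvDefect, LinearMap.sub_apply, LinearMap.comp_apply, map_sub, red_map_res,
    Q.redD.comul, TensorProduct.mk_apply, TensorProduct.map_tmul, Q.redG.map_one]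

theorem red_cobar (z : HG ⊗[DualNumber k] HD) :
    TensorProduct.map Q.redG.map (TensorProduct.map Q.redG.map Q.redD.map) (cobar Q.res z) =
      cobar P.res (TensorProduct.map Q.redG.map Q.redD.map z) := by
  induction z with
  | zero => simp only [map_zero]
  | add s t hs ht => simp only [map_add, hs, ht]
  | tmul a b =>
    simp only [cobar, LinearMap.sub_apply, LinearMap.comp_apply, map_sub, LinearEquiv.coe_coe,
      LinearMap.rTensor_tmul, LinearMap.lTensor_tmul, TensorProduct.map_tmul,
      TensorProduct.mk_apply, red_map_res, Q.redG.comul, Q.redD.comul, Q.redG.map_one]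
    congr 2
    generalize Coalgebra.comul (R := DualNumber k) a = s
    induction s with
    | zero => simp only [map_zero, TensorProduct.zero_tmul]
    | add s t hs ht => simp only [map_add, TensorProduct.add_tmul, hs, ht]
    | tmul c d => simp only [TensorProduct.assoc_tmul, TensorProduct.map_tmul]

/-- Coinvariants lift to the deformation as soon as the cobar complex is exact in degree one: the
defect of a lift to be coinvariant is `ħ` times a cocycle. -/
theorem exists_coinv_lift [Module.Flat (DualNumber k) HD] [Module.Flat (DualNumber k) HG]
    (hex : ∀ z : OG ⊗[k] OD, cobar P.res z = 0 → ∃ w, coinvDefect P.res w = z)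
    (f₁ : P.quotientAlgebra) : ∃ x : coinv Q.res, Q.redD.map x = f₁ := by
  have hD := Q.redD.isReduction
  have hG := Q.redG.isReduction
  obtain ⟨y, hy⟩ := hD.surjective (f₁ : OD)
  have h0 : TensorProduct.map Q.redG.map Q.redD.map (coinvDefect Q.res y) = 0 := by
    rw [red_coinvDefect, hy]
    exact (coinvDefect_eq_zero_iff P.res _).2 f₁.2
  obtain ⟨z, hz⟩ := ((hG.tensor hD).ker _).1 h0
  have hcoc : cobar P.res (TensorProduct.map Q.redG.map Q.redD.map z) = 0 := by
    rw [← red_cobar, ← (hG.tensor (hG.tensor hD)).eps_smul_eq_zero_iff, ← map_smul, ← hz,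
      cobar_coinvDefect]
  obtain ⟨w, hw⟩ := hex _ hcoc
  obtain ⟨v, rfl⟩ := hD.surjective w
  refine ⟨⟨y - (DualNumber.eps : DualNumber k) • v, ?_⟩, ?_⟩
  · rw [← coinvDefect_eq_zero_iff, map_sub, map_smul, hz, ← smul_sub,
      (hG.tensor hD).eps_smul_eq_zero_iff, map_sub, red_coinvDefect, hw, sub_self]
  · change Q.redD.map (y - (DualNumber.eps : DualNumber k) • v) = f₁
    rw [map_sub, red_eps_smul, sub_zero, hy]

end Coinvariants

/-! ### Exactness of the cobar complex over an affine quotient -/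

section Descent

variable {k OD OG : Type*} [CommRing k] [CommRing OD] [HopfAlgebra k OD]
    [CommRing OG] [HopfAlgebra k OG] (P : GroupPair k OD OG)


/-- `a ⊗ b ↦ S(b) ⊗ a`. -/
def antipodeSwap : OD ⊗[k] OD →ₐ[k] OD ⊗[P.quotientAlgebra] OD :=
  Algebra.TensorProduct.lift
    ((Algebra.TensorProduct.includeRight : OD →ₐ[P.quotientAlgebra]
      OD ⊗[P.quotientAlgebra] OD).restrictScalars k)
    ((Algebra.TensorProduct.includeLeft : OD →ₐ[k] OD ⊗[P.quotientAlgebra] OD).comp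
      (HopfAlgebra.antipodeAlgHom k OD))
    (fun _ _ => Commute.all _ _)

theorem antipodeSwap_tmul (a b : OD) :
    antipodeSwap P (a ⊗ₜ b) = HopfAlgebra.antipode k b ⊗ₜ[P.quotientAlgebra] a := by
  simp [antipodeSwap]

/-- The map `D ×_{D/G} D → D`, `(d', d) ↦ d d'⁻¹`, given by `a ↦ S(a₍₂₎) ⊗ a₍₁₎`. -/
def differenceMap : OD →ₐ[k] OD ⊗[P.quotientAlgebra] OD :=
  (antipodeSwap P).comp (Bialgebra.comulAlgHom k OD)

theorem differenceMap_apply (a : OD) :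
    differenceMap P a = antipodeSwap P (Coalgebra.comul (R := k) a) := rfl

theorem tmul_coinv (u : P.quotientAlgebra) (x : OD) : x ⊗ₜ[P.quotientAlgebra] (u : OD) =
    ((u : OD) * x) ⊗ₜ[P.quotientAlgebra] (1 : OD) := by
  have h := TensorProduct.smul_tmul (R := P.quotientAlgebra) (R' := P.quotientAlgebra) u x (1 : OD)
  rw [Subalgebra.smul_def, Subalgebra.smul_def, smul_eq_mul, smul_eq_mul, mul_one] at h
  exact h.symm

/-- Over `D/G` the difference map takes values in `G`. -/
theorem differenceMap_coinv [Module.Flat k OD] (b : P.quotientAlgebra) :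
    differenceMap P (b : OD) = algebraMap k _ (Coalgebra.counit (R := k) (b : OD)) := by
  have key : ∀ t : P.quotientAlgebra ⊗[k] OD,
      antipodeSwap P (P.quotientAlgebra.val.toLinearMap.rTensor OD t) =
      (Algebra.TensorProduct.includeLeft : OD →ₐ[k] OD ⊗[P.quotientAlgebra] OD)
        (LinearMap.mul' k OD ((HopfAlgebra.antipode k (A := OD)).lTensor OD
          (P.quotientAlgebra.val.toLinearMap.rTensor OD t))) := by
    intro t
    induction t with
    | zero => simp only [map_zero]
    | add s t hs ht => simp only [map_add, hs, ht]
    | tmul u v =>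
      simp only [LinearMap.rTensor_tmul, LinearMap.lTensor_tmul, LinearMap.mul'_apply,
        antipodeSwap_tmul, Algebra.TensorProduct.includeLeft_apply]
      exact tmul_coinv P u _
  rw [differenceMap_apply, ← rTensor_coinvCoact, key, rTensor_coinvCoact,
    HopfAlgebra.mul_antipode_lTensor_comul_apply, AlgHom.commutes]

/-- The difference map `D ×_{D/G} D → G`. -/
theorem exists_differenceMap_restrict [Module.Flat k OD]
    (hker : RingHom.ker P.res =
      Ideal.span {b | b ∈ P.quotientAlgebra ∧ Coalgebra.counit (R := k) b = 0}) :
    ∃ γ : OG →ₐ[k] OD ⊗[P.quotientAlgebra] OD, ∀ a, γ (P.res a) = differenceMap P a := by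
  have hle : RingHom.ker (P.res : OD →ₐ[k] OG).toRingHom ≤
      RingHom.ker (differenceMap P).toRingHom := by
    have : RingHom.ker (P.res : OD →ₐ[k] OG).toRingHom = RingHom.ker P.res := rfl
    rw [this, hker, Ideal.span_le]
    rintro b ⟨hb, hb0⟩
    change differenceMap P b = 0
    rw [differenceMap_coinv P ⟨b, hb⟩, hb0, map_zero]
  refine ⟨AlgHom.liftOfSurjective (P.res : OD →ₐ[k] OG) P.res_surjective (differenceMap P) hle,
    fun a => ?_⟩
  exact AlgHom.liftOfSurjective_apply _ P.res_surjective _ hle a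

/-- The right-hand version `d ↦ d₍₂₎ ⊗ f(d₍₁₎)` of the coaction of `𝒪(G)` on `𝒪(D)`; it is linear
over `𝒪(D/G)`. -/
def swappedCoact : OD →ₐ[P.quotientAlgebra] OD ⊗[k] OG :=
  { ((Algebra.TensorProduct.comm k OG OD).toAlgHom.comp
      (Algebra.TensorProduct.map (P.res : OD →ₐ[k] OG) (AlgHom.id k OD))).comp
      (Bialgebra.comulAlgHom k OD) with
    commutes' := fun b => by
      have hb : TensorProduct.map (P.res : OD →ₐ[k] OG).toLinearMap LinearMap.id
          (Coalgebra.comul (R := k) (b : OD)) = 1 ⊗ₜ (b : OD) := by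
        have := (coinvDefect_eq_zero_iff P.res (b : OD)).2 b.2
        rw [coinvDefect, LinearMap.sub_apply, sub_eq_zero] at this
        exact this
      change TensorProduct.comm k OG OD
        (TensorProduct.map (P.res : OD →ₐ[k] OG).toLinearMap LinearMap.id
          (Coalgebra.comul (R := k) (b : OD))) = _
      rw [hb]
      rfl }

theorem swappedCoact_apply (d : OD) : swappedCoact P d = TensorProduct.comm k OG OD
    (TensorProduct.map (P.res : OD →ₐ[k] OG).toLinearMap LinearMap.id
      (Coalgebra.comul (R := k) d)) := rfl


/-- The map `d ↦ d₍₂₎ ⊗ f(d₍₁₎) - d ⊗ 1`, linear over `𝒪(D/G)`. -/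
def swappedDefect : OD →ₗ[P.quotientAlgebra] OD ⊗[k] OG where
  toFun d := swappedCoact P d - d ⊗ₜ[k] (1 : OG)
  map_add' d d' := by rw [map_add, TensorProduct.add_tmul, add_sub_add_comm]
  map_smul' b d := by
    rw [map_smul, RingHom.id_apply, smul_sub]
    rfl

theorem swappedDefect_apply (d : OD) :
    swappedDefect P d = swappedCoact P d - d ⊗ₜ[k] (1 : OG) := rfl

/-- A map `γ` on `𝒪(G)` extended to `𝒪(G) ⊗ 𝒪(D)` by `d ↦ d ⊗ 1`. For the difference map `γ`, this
is the isomorphism `D ×_{D/G} D ≅ G × D`. -/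
def extendLeft (γ : OG →ₐ[k] OD ⊗[P.quotientAlgebra] OD) :
    OG ⊗[k] OD →ₐ[k] OD ⊗[P.quotientAlgebra] OD :=
  Algebra.TensorProduct.lift γ
    (Algebra.TensorProduct.includeLeft : OD →ₐ[k] OD ⊗[P.quotientAlgebra] OD)
    (fun _ _ => Commute.all _ _)

theorem extendLeft_tmul (γ : OG →ₐ[k] OD ⊗[P.quotientAlgebra] OD) (g : OG) (d : OD) :
    extendLeft P γ (g ⊗ₜ d) = γ g * d ⊗ₜ[P.quotientAlgebra] (1 : OD) := by
  simp [extendLeft]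

theorem extendLeft_res_comul (γ : OG →ₐ[k] OD ⊗[P.quotientAlgebra] OD)
    (hγ : ∀ a, γ (P.res a) = differenceMap P a) (d : OD) :
    extendLeft P γ (TensorProduct.map (P.res : OD →ₐ[k] OG).toLinearMap LinearMap.id
        (Coalgebra.comul (R := k) d)) = 1 ⊗ₜ d := by
  let inL := (Algebra.TensorProduct.includeLeft : OD →ₐ[k] OD ⊗[P.quotientAlgebra] OD)
  let inR := (Algebra.TensorProduct.includeRight : OD →ₐ[P.quotientAlgebra]
      OD ⊗[P.quotientAlgebra] OD).restrictScalars k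
  -- `x ⊗ y ⊗ z ↦ S(y) z ⊗ x`
  let Ψ : OD ⊗[k] (OD ⊗[k] OD) →ₐ[k] OD ⊗[P.quotientAlgebra] OD :=
    Algebra.TensorProduct.lift inR (Algebra.TensorProduct.lift
      (inL.comp (HopfAlgebra.antipodeAlgHom k OD)) inL (fun _ _ => Commute.all _ _))
      (fun _ _ => Commute.all _ _)
  have hΨ : ∀ x y z, Ψ (x ⊗ₜ (y ⊗ₜ z)) =
      (HopfAlgebra.antipode k y * z) ⊗ₜ[P.quotientAlgebra] x := fun x y z => by
    simp [Ψ, inL, inR]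
  have hA : ∀ t : OD ⊗[k] OD,
      extendLeft P γ (TensorProduct.map (P.res : OD →ₐ[k] OG).toLinearMap LinearMap.id t) =
        Ψ (TensorProduct.assoc k OD OD OD ((Coalgebra.comul (R := k)).rTensor OD t)) := by
    intro t
    induction t with
    | zero => simp only [map_zero]
    | add s t hs ht => simp only [map_add, hs, ht]
    | tmul a b =>
      have h1 : extendLeft P γ (TensorProduct.map (P.res : OD →ₐ[k] OG).toLinearMap
          LinearMap.id (a ⊗ₜ b)) =
          antipodeSwap P (Coalgebra.comul (R := k) a) * b ⊗ₜ[P.quotientAlgebra] (1 : OD) := by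
        rw [TensorProduct.map_tmul, extendLeft_tmul, ← differenceMap_apply, ← hγ]
        rfl
      rw [h1, LinearMap.rTensor_tmul]
      generalize Coalgebra.comul (R := k) a = s
      induction s with
      | zero => simp only [map_zero, TensorProduct.zero_tmul, zero_mul]
      | add s t hs ht => simp only [map_add, TensorProduct.add_tmul, add_mul, hs, ht]
      | tmul x y =>
        rw [TensorProduct.assoc_tmul, hΨ, antipodeSwap_tmul, Algebra.TensorProduct.tmul_mul_tmul,
          mul_one]
  have hB : ∀ t : OD ⊗[k] OD, Ψ ((Coalgebra.comul (R := k)).lTensor OD t) =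
      inR (TensorProduct.rid k OD ((Coalgebra.counit (R := k)).lTensor OD t)) := by
    intro t
    induction t with
    | zero => simp only [map_zero]
    | add s t hs ht => simp only [map_add, hs, ht]
    | tmul x y =>
      have h1 : ∀ s : OD ⊗[k] OD, Ψ (x ⊗ₜ s) =
          inR x * inL (LinearMap.mul' k OD ((HopfAlgebra.antipode k).rTensor OD s)) := by
        intro s
        induction s with
        | zero => simp only [map_zero, TensorProduct.tmul_zero, mul_zero]
        | add s t hs ht => simp only [map_add, TensorProduct.tmul_add, mul_add, hs, ht]
        | tmul y z => rw [hΨ]; simp [inL, inR]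
      rw [LinearMap.lTensor_tmul, h1, HopfAlgebra.mul_antipode_rTensor_comul_apply,
        AlgHom.commutes, LinearMap.lTensor_tmul, TensorProduct.rid_tmul, map_smul,
        Algebra.smul_def, mul_comm]
  rw [hA, Coalgebra.coassoc_apply, hB, Coalgebra.lTensor_counit_comul, TensorProduct.rid_tmul,
    one_smul]
  rfl

/-- After the faithfully flat base change along `D → D/G`, the map `d ↦ f(d₍₁₎) ⊗ d₍₂₎ - 1 ⊗ d`
hits every cocycle `z`: a preimage of `1 ⊗ z` is the image of `z` under `extendLeft`. -/
theorem lTensor_defect_extendLeft (γ : OG →ₐ[k] OD ⊗[P.quotientAlgebra] OD)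
    (hγ : ∀ a, γ (P.res a) = differenceMap P a) (z : OG ⊗[k] OD) (hz : cobar P.res z = 0) :
    (swappedDefect P).lTensor OD (extendLeft P γ z) =
      (1 : OD) ⊗ₜ[P.quotientAlgebra] TensorProduct.comm k OG OD z := by
  let i₀ : OD →ₐ[P.quotientAlgebra] OD ⊗[k] OG := Algebra.TensorProduct.includeLeft
  let j : OD ⊗[P.quotientAlgebra] OD →ₐ[P.quotientAlgebra] OD ⊗[P.quotientAlgebra] (OD ⊗[k] OG) :=
    Algebra.TensorProduct.map (AlgHom.id _ OD) i₀
  let j' : OD ⊗[P.quotientAlgebra] OD →ₐ[P.quotientAlgebra] OD ⊗[P.quotientAlgebra] (OD ⊗[k] OG) :=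
    Algebra.TensorProduct.map (AlgHom.id _ OD) (swappedCoact P)
  let ιG : OG →ₐ[k] OD ⊗[P.quotientAlgebra] (OD ⊗[k] OG) :=
    ((Algebra.TensorProduct.includeRight : OD ⊗[k] OG →ₐ[P.quotientAlgebra]
      OD ⊗[P.quotientAlgebra] (OD ⊗[k] OG)).restrictScalars k).comp
      Algebra.TensorProduct.includeRight
  -- `g ⊗ u ↦ extendLeft u` with `g` in the last factor
  let Γ : OG ⊗[k] (OG ⊗[k] OD) →ₐ[k] OD ⊗[P.quotientAlgebra] (OD ⊗[k] OG) :=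
    Algebra.TensorProduct.lift ιG ((j.restrictScalars k).comp (extendLeft P γ))
      (fun _ _ => Commute.all _ _)
  have hΓ : ∀ g u, Γ (g ⊗ₜ u) = ιG g * j (extendLeft P γ u) := fun g u => by
    simp [Γ]
  have hj : ∀ x y, j (x ⊗ₜ y) = x ⊗ₜ (y ⊗ₜ (1 : OG)) := fun x y => rfl
  have hj' : ∀ x y, j' (x ⊗ₜ y) = x ⊗ₜ swappedCoact P y := fun x y => rfl
  have hιG : ∀ g, ιG g = (1 : OD) ⊗ₜ ((1 : OD) ⊗ₜ g) := fun g => rfl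
  -- `x ⊗ y ⊗ w ↦ S(w) ⊗ y ⊗ f(x)`
  let Φ : OD ⊗[k] (OD ⊗[k] OD) →ₐ[k] OD ⊗[P.quotientAlgebra] (OD ⊗[k] OG) :=
    Algebra.TensorProduct.lift (ιG.comp (P.res : OD →ₐ[k] OG))
      ((j.restrictScalars k).comp (antipodeSwap P)) (fun _ _ => Commute.all _ _)
  have hΦ' : ∀ x u, Φ (x ⊗ₜ u) = ιG (P.res x) * j (antipodeSwap P u) := fun x u => by
    simp [Φ]
  have hΦ : ∀ x y w, Φ (x ⊗ₜ (y ⊗ₜ w)) =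
      HopfAlgebra.antipode k w ⊗ₜ[P.quotientAlgebra] (y ⊗ₜ[k] P.res x) := fun x y w => by
    rw [hΦ', antipodeSwap_tmul, hj, hιG, Algebra.TensorProduct.tmul_mul_tmul,
      Algebra.TensorProduct.tmul_mul_tmul, one_mul, one_mul, mul_one]
  have h1 : ∀ t : OD ⊗[k] OD, j' (antipodeSwap P t) =
      Φ (TensorProduct.assoc k OD OD OD ((Coalgebra.comul (R := k)).rTensor OD t)) := by
    intro t
    induction t with
    | zero => simp only [map_zero]
    | add s t hs ht => simp only [map_add, hs, ht]
    | tmul a b =>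
      rw [antipodeSwap_tmul, hj', swappedCoact_apply, LinearMap.rTensor_tmul]
      generalize Coalgebra.comul (R := k) a = s
      induction s with
      | zero => simp only [map_zero, TensorProduct.zero_tmul, TensorProduct.tmul_zero]
      | add s t hs ht => simp only [map_add, TensorProduct.add_tmul, TensorProduct.tmul_add, hs, ht]
      | tmul x y =>
        rw [TensorProduct.assoc_tmul, hΦ]
        rfl
  have h2 : ∀ (t : OD ⊗[k] OD) (d : OD), Γ (TensorProduct.assoc k OG OG OD
      (TensorProduct.map (P.res : OD →ₐ[k] OG).toLinearMap (P.res : OD →ₐ[k] OG).toLinearMap t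
        ⊗ₜ d)) = Φ ((Coalgebra.comul (R := k)).lTensor OD t) *
          d ⊗ₜ[P.quotientAlgebra] ((1 : OD) ⊗ₜ[k] (1 : OG)) := by
    intro t d
    induction t with
    | zero => simp only [map_zero, TensorProduct.zero_tmul, zero_mul]
    | add s t hs ht => simp only [map_add, TensorProduct.add_tmul, add_mul, hs, ht]
    | tmul x y =>
      rw [TensorProduct.map_tmul, TensorProduct.assoc_tmul, hΓ, LinearMap.lTensor_tmul, hΦ',
        extendLeft_tmul, map_mul, hj, ← differenceMap_apply, ← hγ, ← mul_assoc]
      rfl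
  have hI : ∀ z : OG ⊗[k] OD, j' (extendLeft P γ z) =
      Γ (TensorProduct.assoc k OG OG OD ((Coalgebra.comul (R := k)).rTensor OD z)) := by
    intro z
    induction z with
    | zero => simp only [map_zero]
    | add s t hs ht => simp only [map_add, hs, ht]
    | tmul g d =>
      obtain ⟨a, rfl⟩ := P.res_surjective g
      have hc : Coalgebra.comul (R := k) (P.res a) =
          TensorProduct.map (P.res : OD →ₐ[k] OG).toLinearMap (P.res : OD →ₐ[k] OG).toLinearMap
            (Coalgebra.comul (R := k) a) := (CoalgHomClass.map_comp_comul_apply P.res a).symm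
      rw [LinearMap.rTensor_tmul, hc, h2, ← Coalgebra.coassoc_apply, ← h1, ← differenceMap_apply,
        extendLeft_tmul, map_mul, hγ, hj', map_one]
      rfl
  have hII : ∀ z : OG ⊗[k] OD, j (extendLeft P γ z) = Γ (1 ⊗ₜ z) := fun z => by
    rw [hΓ, map_one, one_mul]
  have hIII : ∀ z : OG ⊗[k] OD, (1 : OD) ⊗ₜ[P.quotientAlgebra] TensorProduct.comm k OG OD z =
      Γ ((TensorProduct.map (P.res : OD →ₐ[k] OG).toLinearMap LinearMap.id ∘ₗ
        Coalgebra.comul (R := k) (A := OD)).lTensor OG z) := by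
    intro z
    induction z with
    | zero => simp only [map_zero, TensorProduct.tmul_zero]
    | add s t hs ht => simp only [map_add, TensorProduct.tmul_add, hs, ht]
    | tmul g d =>
      rw [LinearMap.lTensor_tmul, LinearMap.comp_apply, hΓ, extendLeft_res_comul P γ hγ, hj, hιG,
        Algebra.TensorProduct.tmul_mul_tmul, Algebra.TensorProduct.tmul_mul_tmul, one_mul, one_mul,
        mul_one]
      rfl
  -- `hI`, `hII` and `hIII` identify the three terms of the cocycle condition, pushed forward by `Γ`
  have hz' := congrArg Γ hz
  simp only [cobar, LinearMap.sub_apply, LinearMap.comp_apply, map_sub, LinearEquiv.coe_coe,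
    map_zero, TensorProduct.mk_apply, ← hI, ← hII, ← hIII] at hz'
  have hdef : ∀ u, (swappedDefect P).lTensor OD u = j' u - j u := by
    intro u
    induction u with
    | zero => simp only [map_zero, sub_zero]
    | add s t hs ht =>
      simp only [map_add, hs, ht]
      abel
    | tmul x y =>
      rw [LinearMap.lTensor_tmul, swappedDefect_apply, hj, hj', TensorProduct.tmul_sub]
  rw [hdef]
  rw [sub_sub, sub_eq_zero] at hz'
  rw [hz', add_sub_cancel_right]

/-- If `D/G` is affine, the cobar complex is exact in degree one. -/
theorem exists_coinvDefect_eq [Module.Flat k OD] (hP : P.AffineQuotient) (z : OG ⊗[k] OD)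
    (hz : cobar P.res z = 0) : ∃ w, coinvDefect P.res w = z := by
  obtain ⟨hff, hker⟩ := hP
  obtain ⟨γ, hγ⟩ := exists_differenceMap_restrict P hker
  let δ := swappedDefect P
  have key : (LinearMap.range δ).mkQ (TensorProduct.comm k OG OD z) = 0 := by
    rw [← Module.FaithfullyFlat.one_tmul_eq_zero_iff P.quotientAlgebra _ (A := OD),
      ← LinearMap.lTensor_tmul, ← lTensor_defect_extendLeft P γ hγ z hz,
      ← LinearMap.comp_apply, ← LinearMap.lTensor_comp]
    have : (LinearMap.range δ).mkQ ∘ₗ δ = 0 := LinearMap.range_mkQ_comp δ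
    rw [this, LinearMap.lTensor_zero, LinearMap.zero_apply]
  rw [Submodule.mkQ_apply, Submodule.Quotient.mk_eq_zero] at key
  obtain ⟨w, hw⟩ := key
  refine ⟨w, (TensorProduct.comm k OG OD).injective ?_⟩
  rw [← hw, coinvDefect, LinearMap.sub_apply, map_sub]
  rfl

end Descent

/-! ### The classical limit -/

section Limit

variable {k OD OG HD HG : Type*} [CommRing k] [CommRing OD] [HopfAlgebra k OD]
    [CommRing OG] [HopfAlgebra k OG]
    [Ring HD] [HopfAlgebra (DualNumber k) HD] [Ring HG] [HopfAlgebra (DualNumber k) HG]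
    {P : GroupPair k OD OG} (Q : Quantization P HD HG)

/-- The classical `r`-matrix of a quantization, as a bilinear functional on `𝒪(D) × 𝒪(G)`. -/
theorem exists_classicalR : ∃ r : OD →ₗ[k] OG →ₗ[k] k, ∀ a b, Q.rG a b =
    Coalgebra.counit (R := DualNumber k) a * Coalgebra.counit (R := DualNumber k) b +
      TrivSqZeroExt.inr (r (Q.redD.map a) (Q.redG.map b)) := by
  obtain ⟨r, hr⟩ := exists_bilin_of_red_eq_zero Q.redD.isReduction Q.redG.isReduction
    isReduction_modHbar (Q.rG - (LinearMap.mul (DualNumber k) (DualNumber k)).compl₁₂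
      Coalgebra.counit Coalgebra.counit) (fun a b => by
        have h1 := Q.red_rG a b
        rw [Q.redD.counit, Q.redG.counit, ← map_mul] at h1
        change modHbar k (Q.rG a b -
          Coalgebra.counit (R := DualNumber k) a * Coalgebra.counit (R := DualNumber k) b) = 0
        rw [map_sub, h1, sub_self])
  refine ⟨r, fun a b => ?_⟩
  rw [← hbar_modHbar, ← hr]
  simp

variable {r : OD →ₗ[k] OG →ₗ[k] k}

theorem classicalR_eq (hr : ∀ a b, Q.rG a b =
    Coalgebra.counit (R := DualNumber k) a * Coalgebra.counit (R := DualNumber k) b +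
      TrivSqZeroExt.inr (r (Q.redD.map a) (Q.redG.map b))) (a : HD) (b : HG) :
    classicalR Q.rG a b = r (Q.redD.map a) (Q.redG.map b) := by
  rw [classicalR, hr, add_sub_cancel_left, TrivSqZeroExt.snd_inr]

/-- The classical limit of a relative coquasitriangular structure is the canonical `r`-matrix of a
Lagrangian complement. -/
theorem exists_complement_of_quantization
    (hsurj : Function.Surjective (differentialAtOne (k := k) (O := OD)))
    (hr : ∀ a b, Q.rG a b =
      Coalgebra.counit (R := DualNumber k) a * Coalgebra.counit (R := DualNumber k) b +
        TrivSqZeroExt.inr (r (Q.redD.map a) (Q.redG.map b))) :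
    ∃ h : LagrangianComplement P,
      (∀ x, x ∈ h.carrier ↔ ∃ b, ∀ a, x.1 a = r a b) ∧ h.rMatrix = r := by
  have hskew := Q.relCoquasitriangular.skew
  refine exists_lagrangianComplement P hsurj r (fun a a' b => ?_) (fun a b b' => ?_)
    (fun a a' => ?_)
  · obtain ⟨a, rfl⟩ := Q.redD.surjective a
    obtain ⟨a', rfl⟩ := Q.redD.surjective a'
    obtain ⟨b, rfl⟩ := Q.redG.surjective b
    have h := hskew.mul_left a a' b
    rw [mul'_map_of_counit_add_inr Q.redG.map Coalgebra.counit (Q.rG a) (Q.rG a')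
      (Coalgebra.counit a) (Coalgebra.counit a') (r (Q.redD.map a)) (r (Q.redD.map a'))
      (hr a) (hr a'), Coalgebra.rTensor_counit_comul, Coalgebra.lTensor_counit_comul,
      TensorProduct.lid_tmul, TensorProduct.rid_tmul, one_smul, hr, Bialgebra.counit_mul] at h
    have h' := TrivSqZeroExt.inr_injective (add_left_cancel h)
    rw [Q.redD.map_mul] at h'
    rw [h', Q.redD.counit, Q.redD.counit]
    rfl
  · obtain ⟨a, rfl⟩ := Q.redD.surjective a
    obtain ⟨b, rfl⟩ := Q.redG.surjective b
    obtain ⟨b', rfl⟩ := Q.redG.surjective b'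
    have h := hskew.mul_right a b b'
    have hflip : ∀ c a, Q.rG.flip c a =
        Coalgebra.counit (R := DualNumber k) c * Coalgebra.counit (R := DualNumber k) a +
          TrivSqZeroExt.inr (r.flip (Q.redG.map c) (Q.redD.map a)) := fun c a => by
      rw [LinearMap.flip_apply, hr, mul_comm, LinearMap.flip_apply]
    rw [mul'_map_of_counit_add_inr Q.redD.map Coalgebra.counit (Q.rG.flip b') (Q.rG.flip b)
      (Coalgebra.counit b') (Coalgebra.counit b) (r.flip (Q.redG.map b')) (r.flip (Q.redG.map b))
      (hflip b') (hflip b), Coalgebra.rTensor_counit_comul, Coalgebra.lTensor_counit_comul,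
      TensorProduct.lid_tmul, TensorProduct.rid_tmul, one_smul, hr, Bialgebra.counit_mul,
      mul_comm (Coalgebra.counit (R := DualNumber k) a),
      mul_comm (Coalgebra.counit (R := DualNumber k) b)] at h
    have h' := TrivSqZeroExt.inr_injective (add_left_cancel h)
    rw [Q.redG.map_mul] at h'
    rw [h', Q.redG.counit, Q.redG.counit, LinearMap.flip_apply, LinearMap.flip_apply]
    change _ = TrivSqZeroExt.fst _ * _ + _ * TrivSqZeroExt.fst _
    ring
  · obtain ⟨a, rfl⟩ := Q.redD.surjective a
    obtain ⟨a', rfl⟩ := Q.redD.surjective a'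
    have hcl : ∀ x y, classicalR Q.rD x y = r (Q.redD.map x) (P.res (Q.redD.map y)) := by
      intro x y
      rw [← Q.red_res, ← classicalR_eq Q hr, classicalR, classicalR,
        Q.relCoquasitriangular.compat]
      congr 3
      exact (CoalgHomClass.counit_comp_apply Q.res y).symm
    rw [← Q.symmetric_part, hcl, hcl]

/-- The `R`-matrix relation to first order says that `π_G` is the commutator of `𝒪_ħ(G)`. -/
theorem isGroupBracket_of_commutator [Module.Flat (DualNumber k) HG]
    (h : LagrangianComplement P)
    (hr : ∀ a b, Q.rG a b =
      Coalgebra.counit (R := DualNumber k) a * Coalgebra.counit (R := DualNumber k) b +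
        TrivSqZeroExt.inr (h.rMatrix (Q.redD.map a) (Q.redG.map b)))
    (πG : OG →ₗ[k] OG →ₗ[k] OG)
    (hπG : ∀ a b, a * b - b * a = Q.redG.isReduction.hbar (πG (Q.redG.map a) (Q.redG.map b))) :
    IsGroupBracket h πG := by
  intro d b
  obtain ⟨d, rfl⟩ := Q.redD.surjective d
  obtain ⟨b, rfl⟩ := Q.redG.surjective b
  apply Q.redG.isReduction.hbar_injective
  rw [← Q.red_res, ← hπG, map_sub]
  have h1 := Q.relCoquasitriangular.rmatrix d b
  rw [pairFirst_expand Q.redG.isReduction Q.redD.map Q.redD.map Q.redG.map Q.redG.map Q.rG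
      h.rMatrix Coalgebra.counit Coalgebra.counit hr _
      ((LinearMap.mul k OG) ∘ₗ (P.res : OD →ₐ[k] OG).toLinearMap)
      (fun u v => by
        change Q.redG.map (Q.res u * v) = P.res (Q.redD.map u) * Q.redG.map v
        rw [Q.redG.map_mul, Q.red_res]),
    pairSecond_expand Q.redG.isReduction Q.redD.map Q.redD.map Q.redG.map Q.redG.map Q.rG
      h.rMatrix Coalgebra.counit Coalgebra.counit hr _
      ((LinearMap.mul k OG) ∘ₗ (P.res : OD →ₐ[k] OG).toLinearMap)
      (fun u v => by
        change Q.redG.map (v * Q.res u) = P.res (Q.redD.map u) * Q.redG.map v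
        rw [Q.redG.map_mul, Q.red_res, mul_comm]),
    Coalgebra.rTensor_counit_comul, Coalgebra.rTensor_counit_comul,
    Coalgebra.lTensor_counit_comul, Coalgebra.lTensor_counit_comul,
    TensorProduct.lid_tmul, TensorProduct.rid_tmul, one_smul,
    TensorProduct.lid_tmul, TensorProduct.rid_tmul, one_smul,
    ← Q.redD.comul, ← Q.redG.comul] at h1
  rw [sub_eq_sub_iff_add_eq_add, add_comm (Q.redG.isReduction.hbar _)]
  exact h1.trans (add_comm _ _) |>.trans (add_comm _ _)

section Moment

variable {A OX : Type*} [Ring A] [Algebra (DualNumber k) A] [CommRing OX] [Algebra k OX]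

/-- Compatibility of the action with the brackets is the multiplicativity of the coaction of
`𝒪_ħ(G)` on `A`, to first order. -/
theorem actionCompatible_of_commutator [Module.Flat (DualNumber k) HG]
    [Module.Flat (DualNumber k) A] (h : LagrangianComplement P)
    (hr : ∀ a b, Q.rG a b =
      Coalgebra.counit (R := DualNumber k) a * Coalgebra.counit (R := DualNumber k) b +
        TrivSqZeroExt.inr (h.rMatrix (Q.redD.map a) (Q.redG.map b)))
    (ρ : ComoduleAlgebra k OG OX) (ρh : ComoduleAlgebra (DualNumber k) HG A)
    (redX : AlgReduction k A OX)
    (hredX : ∀ a, ρ.coact (redX.map a) = TensorProduct.map redX.map Q.redG.map (ρh.coact a))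
    (π : Bivector k OX)
    (hπ : ∀ a b, a * b - b * a = redX.isReduction.hbar (π.bracket (redX.map a) (redX.map b))) :
    ActionCompatible h ρ π := by
  obtain ⟨πG, hπG⟩ := exists_bivector_of_commutator Q.redG.toAlgReduction
  refine ⟨πG.bracket, isGroupBracket_of_commutator Q h hr _ hπG, fun f g => ?_⟩
  obtain ⟨a, rfl⟩ := redX.surjective f
  obtain ⟨b, rfl⟩ := redX.surjective g
  apply (redX.isReduction.tensor Q.redG.isReduction).hbar_injective
  rw [hredX a, hredX b, ← commutator_tensor redX Q.redG.toAlgReduction _ _ hπ hπG, ← map_mul,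
    ← map_mul, ← map_sub, hπ]
  obtain ⟨c, hc⟩ := redX.surjective (π.bracket (redX.map a) (redX.map b))
  rw [← hc, hredX, IsReduction.hbar_red, IsReduction.hbar_red, map_smul]

/-- Reduction modulo `ħ` of coinvariants. -/
def coinvRed : coinv Q.res →ₛₗ[modHbar k] P.quotientAlgebra where
  toFun x := ⟨Q.redD.map x, by
    rw [← coinvDefect_eq_zero_iff, ← red_coinvDefect, (coinvDefect_eq_zero_iff _ _).2 x.2,
      map_zero]⟩
  map_add' x y := Subtype.ext (map_add Q.redD.map (x : HD) (y : HD))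
  map_smul' c x := Subtype.ext (Q.redD.map.map_smulₛₗ c (x : HD))

theorem coinvRed_coinvCoact [Module.Flat k OD] [Module.Flat (DualNumber k) HD]
    (x : coinv Q.res) :
    TensorProduct.map (coinvRed Q) Q.redD.map (coinvCoact Q.res x) =
      coinvCoact P.res (coinvRed Q x) := by
  have key : ∀ t : coinv Q.res ⊗[DualNumber k] HD,
      P.quotientAlgebra.val.toLinearMap.rTensor OD
        (TensorProduct.map (coinvRed Q) Q.redD.map t) =
      TensorProduct.map Q.redD.map Q.redD.map ((coinv Q.res).val.toLinearMap.rTensor HD t) := by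
    intro t
    induction t with
    | zero => simp only [map_zero]
    | add s t hs ht => simp only [map_add, hs, ht]
    | tmul u v => rfl
  apply coinv_rTensor_injective P.res
  rw [rTensor_coinvCoact, key, rTensor_coinvCoact, ← Q.redD.comul]
  rfl

theorem rid_lTensor_coinvCoact {R H K : Type*} [CommRing R] [Ring H] [Bialgebra R H] [Ring K]
    [Bialgebra R K] [Module.Flat R H] (f : H →ₐc[R] K) (x : coinv f) :
    TensorProduct.rid R (coinv f) ((Coalgebra.counit (R := R)).lTensor _ (coinvCoact f x)) = x := by
  have key : ∀ t : coinv f ⊗[R] H,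
      ((TensorProduct.rid R (coinv f) ((Coalgebra.counit (R := R)).lTensor _ t) : coinv f) : H) =
      TensorProduct.rid R H ((Coalgebra.counit (R := R)).lTensor _
        ((coinv f).val.toLinearMap.rTensor H t)) := by
    intro t
    induction t with
    | zero => simp
    | add s t hs ht => simp only [map_add, Subalgebra.coe_add, hs, ht]
    | tmul u v => simp
  ext
  rw [key, rTensor_coinvCoact, Coalgebra.lTensor_counit_comul, TensorProduct.rid_tmul, one_smul]

/-- The right-hand side of the moment map equation is the contraction of the two coactions with
`r_𝔥`. -/
theorem momentEquation_of_pairing [Module.Flat k OD] (h : LagrangianComplement P)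
    (ρ : ComoduleAlgebra k OG OX) (π : Bivector k OX) (μ : P.quotientAlgebra →ₐ[k] OX)
    (f₁ : P.quotientAlgebra) (f₂ : OX)
    (heq : π.bracket (μ f₁) f₂ = pairSecond ((LinearMap.mul k OX) ∘ₗ μ.toLinearMap) h.rMatrix
      (coinvCoact P.res f₁) (ρ.coact f₂)) :
    MomentEquation h ρ π μ f₁ f₂ := by
  intro n e
  have key : ∀ (s : P.quotientAlgebra ⊗[k] OD) (t : OX ⊗[k] OG),
      pairSecond ((LinearMap.mul k OX) ∘ₗ μ.toLinearMap) h.rMatrix s t =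
      ∑ i, μ (TensorProduct.rid k _ ((e i).1.lTensor _ s)) *
        TensorProduct.rid k _ ((h.proj (e.coord i)).1.lTensor _ t) := by
    intro s t
    unfold pairSecond
    induction s with
    | zero => simp
    | add s s' hs hs' =>
      simp only [map_add, LinearMap.add_apply, hs, hs', add_mul, Finset.sum_add_distrib]
    | tmul u a =>
      induction t with
      | zero => simp
      | add t t' ht ht' => simp only [map_add, ht, ht', mul_add, Finset.sum_add_distrib]
      | tmul v b =>
        have hr : h.rMatrix a b = ∑ i, (e i).1 a * (h.proj (e.coord i)).1 b := by
          have h1 : differentialAtOne (k := k) a = ∑ i, (e i).1 a • e.coord i :=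
            (e.sum_dual_apply_smul_coord (differentialAtOne (k := k) a)).symm
          change (h.proj (differentialAtOne a)).1 b = _
          rw [h1]
          simp [map_sum]
        simp only [TensorProduct.map₂_apply_tmul, TensorProduct.map_tmul, TensorProduct.rid_tmul,
          LinearMap.lTensor_tmul, map_smul, hr, Finset.sum_smul]
        refine Finset.sum_congr rfl fun i _ => ?_
        simp only [LinearMap.comp_apply, LinearMap.mul_apply', AlgHom.toLinearMap_apply,
          smul_mul_smul_comm]
  rw [heq, key]
  rfl

/-- The quantum moment map equation to first order. -/
theorem bracket_moment [Module.Flat k OD] [Module.Flat (DualNumber k) HD]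
    [Module.Flat (DualNumber k) A]
    (h : LagrangianComplement P)
    (hr : ∀ a b, Q.rG a b =
      Coalgebra.counit (R := DualNumber k) a * Coalgebra.counit (R := DualNumber k) b +
        TrivSqZeroExt.inr (h.rMatrix (Q.redD.map a) (Q.redG.map b)))
    (ρ : ComoduleAlgebra k OG OX) (ρh : ComoduleAlgebra (DualNumber k) HG A)
    (redX : AlgReduction k A OX)
    (hredX : ∀ a, ρ.coact (redX.map a) = TensorProduct.map redX.map Q.redG.map (ρh.coact a))
    (π : Bivector k OX)
    (hπ : ∀ a b, a * b - b * a = redX.isReduction.hbar (π.bracket (redX.map a) (redX.map b)))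
    (μ : P.quotientAlgebra →ₐ[k] OX) (μh : coinv Q.res →ₐ[DualNumber k] A)
    (hμh : IsQuantumMomentMap Q.res Q.rG ρh μh)
    (hred : ∀ x, redX.map (μh x) = μ (coinvRed Q x)) (x : coinv Q.res) (f₂ : OX) :
    π.bracket (μ (coinvRed Q x)) f₂ =
      pairSecond ((LinearMap.mul k OX) ∘ₗ μ.toLinearMap) h.rMatrix
        (coinvCoact P.res (coinvRed Q x)) (ρ.coact f₂) := by
  obtain ⟨a, rfl⟩ := redX.surjective f₂
  apply redX.isReduction.hbar_injective
  rw [← hred, ← hπ, hμh.moment, fieldGoal, ← LinearMap.comp_apply, map_pairSecond,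
    pairSecond_expand redX.isReduction (coinvRed Q) Q.redD.map redX.map Q.redG.map Q.rG
      h.rMatrix Coalgebra.counit Coalgebra.counit hr _
      ((LinearMap.mul k OX) ∘ₗ μ.toLinearMap)
      (fun u v => by
        change redX.map (v * μh u) = μ (coinvRed Q u) * redX.map v
        rw [redX.map_mul, hred, mul_comm]),
    rid_lTensor_coinvCoact, ρh.counit, coinvRed_coinvCoact, ← hredX]
  change a * μh x + _ - _ = _
  rw [add_sub_cancel_left]

end Moment

end Limit

end QuantumMoment

end

theorem mainTheorem2 {k OD OG OX HD HG A : Type*} [CommRing k]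
    -- the algebraic groups `D`, `G` and the variety `X`
    [CommRing OD] [HopfAlgebra k OD] [Module.Flat k OD]
    [Module.Free k (QuantumMoment.CotangentAtOne k OD)]
    [Module.Finite k (QuantumMoment.CotangentAtOne k OD)]
    [CommRing OG] [HopfAlgebra k OG]
    [CommRing OX] [Algebra k OX]
    -- the flat deformations `𝒪_ħ(D)`, `𝒪_ħ(G)` and `A_ħ`
    [Ring HD] [HopfAlgebra (DualNumber k) HD] [Module.Flat (DualNumber k) HD]
    [Ring HG] [HopfAlgebra (DualNumber k) HG] [Module.Flat (DualNumber k) HG]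
    [Ring A] [Algebra (DualNumber k) A] [Module.Flat (DualNumber k) A]
    -- the group pair and its quantization
    (P : QuantumMoment.GroupPair k OD OG) (Q : QuantumMoment.Quantization P HD HG)
    -- the `G`-action on `X` and its quantization
    (ρ : QuantumMoment.ComoduleAlgebra k OG OX)
    (ρh : QuantumMoment.ComoduleAlgebra (DualNumber k) HG A)
    (redX : QuantumMoment.AlgReduction k A OX)
    (hredX : ∀ a, ρ.coact (redX.map a) = TensorProduct.map redX.map Q.redG.map (ρh.coact a))
    -- the `G`-equivariant map `μ : X → D/G`
    (μ : P.quotientAlgebra →ₐ[k] OX) (hμ : QuantumMoment.IsEquivariant P ρ μ)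
    -- the quantum moment map, equal to `μ^*` modulo `ħ`
    (μh : QuantumMoment.coinv Q.res →ₐ[DualNumber k] A)
    (hμh : QuantumMoment.IsQuantumMomentMap Q.res Q.rG ρh μh)
    (hred : ∀ (x : QuantumMoment.coinv Q.res) (f : P.quotientAlgebra),
      Q.redD.map x = f → redX.map (μh x) = μ f) :
    ∃ (h : QuantumMoment.LagrangianComplement P) (π : QuantumMoment.Bivector k OX),
      -- `𝔥 = r₂(𝔤*)`, where `r = (𝐫 - ε ⊗ ε) / ħ`
      (∀ x : QuantumMoment.lieAlg k OD, x ∈ h.carrier ↔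
        ∃ b : HG, ∀ a : HD, x.1 (Q.redD.map a) = QuantumMoment.classicalR Q.rG a b) ∧
      -- `π` is the bracket `(ab - ba) / ħ`, and it is compatible with the action of `(G, π_G^𝔥)`
      QuantumMoment.IsClassicalLimit redX π ∧
      QuantumMoment.ActionCompatible h ρ π ∧
      -- the moment map equation, for the functions on `D/G` which lift to `𝓕`
      (∀ (x : QuantumMoment.coinv Q.res) (f₁ : P.quotientAlgebra), Q.redD.map x = f₁ →
        ∀ f₂ : OX, QuantumMoment.MomentEquation h ρ π μ f₁ f₂) ∧
      -- if `D/G` is affine: for all functions on `D/G`, so that `μ` is a classical moment map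
      (P.AffineQuotient →
        (∀ (f₁ : P.quotientAlgebra) (f₂ : OX), QuantumMoment.MomentEquation h ρ π μ f₁ f₂) ∧
        ∀ πX : QuantumMoment.QuasiPoisson P ρ, πX.bivector h = π →
          QuantumMoment.IsMomentMap πX μ) := by
  obtain ⟨r, hr⟩ := QuantumMoment.exists_classicalR Q
  obtain ⟨h, hcar, rfl⟩ := QuantumMoment.exists_complement_of_quantization Q
    QuantumMoment.differentialAtOne_surjective hr
  obtain ⟨π, hπ⟩ := QuantumMoment.exists_bivector_of_commutator redX
  have hmoment : ∀ (x : QuantumMoment.coinv Q.res) (f₁ : P.quotientAlgebra),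
      Q.redD.map x = f₁ → ∀ f₂ : OX, QuantumMoment.MomentEquation h ρ π μ f₁ f₂ := by
    intro x f₁ hx f₂
    obtain rfl : QuantumMoment.coinvRed Q x = f₁ := Subtype.ext hx
    exact QuantumMoment.momentEquation_of_pairing h ρ π μ _ f₂
      (QuantumMoment.bracket_moment Q h hr ρ ρh redX hredX π hπ μ μh hμh
        (fun y => hred y _ rfl) x f₂)
  have hall : P.AffineQuotient → ∀ (f₁ : P.quotientAlgebra) (f₂ : OX),
      QuantumMoment.MomentEquation h ρ π μ f₁ f₂ := by
    intro hP f₁ f₂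
    obtain ⟨x, hx⟩ := QuantumMoment.exists_coinv_lift Q
      (QuantumMoment.exists_coinvDefect_eq P hP) f₁
    exact hmoment x f₁ hx f₂
  refine ⟨h, π, fun x => ?_, fun a b c hc => ?_,
    QuantumMoment.actionCompatible_of_commutator Q h hr ρ ρh redX hredX π hπ, hmoment,
    fun hP => ⟨hall hP, fun πX hπX => ⟨hμ, h, fun f₁ f₂ => ?_⟩⟩⟩
  · rw [hcar]
    constructor
    · rintro ⟨b, hb⟩
      obtain ⟨b, rfl⟩ := Q.redG.surjective b
      exact ⟨b, fun a => by rw [hb, QuantumMoment.classicalR_eq Q hr]⟩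
    · rintro ⟨b, hb⟩
      refine ⟨Q.redG.map b, fun a => ?_⟩
      obtain ⟨a, rfl⟩ := Q.redD.surjective a
      rw [hb, QuantumMoment.classicalR_eq Q hr]
  · rw [hπ, ← hc, QuantumMoment.IsReduction.hbar_red]
  · rw [hπX]
    exact hall hP f₁ f₂
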